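/- Let $n\ge 2$. All graphs are directed, without loops, on the nodes $0,1,\dots,n$, with every edge colored black or red. **Signed sets.** Let $S_1$ be the set of pairs $\{A,B\}$ where $A$ has no edge out of node $0$ and exactly one edge out of every other node, $B$ has no edge out of nodes $0,1,2$ and exactly one edge out of every other node, every directed cycle of $A$ or of $B$ is either entirely red or entirely black, and every edge not on a cycle is black. Let $S_2$ be the set of pairs $\{A,B\}$ where $A$ has no edge out of nodes $0,2$ and exactly one edge out of every other node, $B$ has no edge out of nodes $0,1$ and exactly one edge out of every other node, and the same coloring condition holds; here, if $A$ contains a directed path $1\to 2$ and $B$ contains a directed path $2\to 1$, then these two paths together (the forbidden meta-cycle) also count as a single cycle. In both sets a pair is positive if its number of red cycles is even, and negative otherwise. In a pair, $A$ always denotes the graph with an edge out of node $1$. The signed set $S_1-S_2$ is the disjoint union of $S_1$ and $S_2$ with the signs of the elements of $S_2$ reversed. **The map $\phi_1$.** Let $\{A,B\}$ be an element of $S_1$ or $S_2$. If the edge out of node $1$ in $A$ is black, $\phi_1$ moves this edge from $A$ to $B$. If it is red, form the crabwalk graph from the red edges of $A$ (dark) and the red edges of $B$ (light). The crabwalk starts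 by traveling along the dark edge out of $1$. It travels forward along dark edges until it reaches a node with a light edge into it, then backward along light edges, starting with that one, until it reaches a node with a dark edge out of it, then forward along dark edges again, starting with that one, and so on; it ends as soon as it reaches node $1$ or node $2$. Then $\phi_1$ moves each dark edge traveled from $A$ to $B$ and each light edge traveled from $B$ to $A$. Moreover, if two dark edges $u\to x$, $x\to y$ are traveled consecutively, the black edge of $B$ out of $x$ moves to $A$, and if two light edges $x\to t$, $u\to x$ are traveled consecutively, the black edge of $A$ out of $x$ moves to $B$. Edges keep their color (black or red) when moved. **Theorem.** On $S_1-S_2$ the map $\phi_1$ is well defined (in particular, the crabwalk always ends), it maps $S_1-S_2$ to itself, and it is a sign-reversing involution: $\phi_1(\phi_1(x))=x$ and $\operatorname{sign}(\phi_1(x))=-\operatorname{sign}(x)$ for all $x\in S_1-S_2$. -/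

import Mathlib

namespace RedHotPotato

/-- Edges are colored black or red. -/
inductive EdgeColor where
  | black
  | red

/-- A colored directed edge `src → tgt` on the nodes `0, 1, …, n`. -/
structure Edge (n : ℕ) where
  src : Fin (n + 1)
  tgt : Fin (n + 1)
  color : EdgeColor

/-- A directed graph on the nodes `0, 1, …, n` with colored edges, given by its set of edges. -/
abbrev ColoredGraph (n : ℕ) : Type := Set (Edge n)

/-- `u → v` is an edge of `G`, of any color. -/
def Adj {n : ℕ} (G : ColoredGraph n) (u v : Fin (n + 1)) : Prop :=
  ∃ c : EdgeColor, (⟨u, v, c⟩ : Edge n) ∈ G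

/-- `u → v` is a red edge of `G`. -/
def RedAdj {n : ℕ} (G : ColoredGraph n) (u v : Fin (n + 1)) : Prop :=
  (⟨u, v, EdgeColor.red⟩ : Edge n) ∈ G

/-- `G` has no loops, no edge out of the nodes in `U`, and exactly one edge out of every
other node. -/
def HasOutEdgesExactlyOff {n : ℕ} (G : ColoredGraph n) (U : Set (Fin (n + 1))) : Prop :=
  (∀ e ∈ G, e.src ≠ e.tgt) ∧ (∀ e ∈ G, e.src ∉ U) ∧ ∀ v, v ∉ U → ∃! e : Edge n, e ∈ G ∧ e.src = v

/-- All edges of `G` that come out of nodes in `X` have color `c`. -/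
def EdgesOutOfHaveColor {n : ℕ} (G : ColoredGraph n) (X : Set (Fin (n + 1))) (c : EdgeColor) :
    Prop :=
  ∀ e ∈ G, e.src ∈ X → e.color = c

/-- `C` is the set of nodes of a directed cycle of `G`: the nodes visited by walking from some
node `v` to which one can walk back. All graphs below have at most one edge out of each node, so
a cycle is determined by its nodes, and its edges are the edges out of its nodes. -/
def IsCycle {n : ℕ} (G : ColoredGraph n) (C : Set (Fin (n + 1))) : Prop :=
  ∃ v, Relation.TransGen (Adj G) v v ∧ C = {w | Relation.TransGen (Adj G) v w}

/-- The nodes out of which the edges of the meta-edge (directed path) from `i` to `j` come; it is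
used when each node has at most one out-edge and `j` has none. -/
def metaEdge {n : ℕ} (G : ColoredGraph n) (i j : Fin (n + 1)) : Set (Fin (n + 1)) :=
  {v | Relation.ReflTransGen (Adj G) i v ∧ Relation.TransGen (Adj G) v j}

/-- The pair has a forbidden meta-cycle: a meta-edge `1 → 2` in `A` and a meta-edge `2 → 1`
in `B`. -/
def HasForbiddenMetaCycle {n : ℕ} (A B : ColoredGraph n) : Prop :=
  Relation.TransGen (Adj A) 1 2 ∧ Relation.TransGen (Adj B) 2 1

/-- All edges of the meta-edges `1 → 2` in `A` and `2 → 1` in `B` have color `c`. -/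
def MetaCycleHasColor {n : ℕ} (A B : ColoredGraph n) (c : EdgeColor) : Prop :=
  EdgesOutOfHaveColor A (metaEdge A 1 2) c ∧ EdgesOutOfHaveColor B (metaEdge B 2 1) c

/-- The number of red cycles of one graph. -/
noncomputable def numRedCycles {n : ℕ} (G : ColoredGraph n) : ℕ :=
  {C | IsCycle G C ∧ EdgesOutOfHaveColor G C EdgeColor.red}.ncard

open Classical in
/-- `1` if there is a red forbidden meta-cycle and `0` otherwise. -/
noncomputable def numRedMetaCycles {n : ℕ} (A B : ColoredGraph n) : ℕ :=
  if HasForbiddenMetaCycle A B ∧ MetaCycleHasColor A B EdgeColor.red then 1 else 0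

/-- A set whose elements are positive or negative. -/
structure SignedSet where
  carrier : Type
  sign : carrier → ℤˣ

/-- The difference `S - T` of signed sets: the disjoint union of `S` and of `T` with all signs of
`T` reversed. -/
instance : Sub SignedSet where
  sub S T := ⟨S.carrier ⊕ T.carrier, Sum.elim S.sign fun t => - T.sign t⟩

/-- `f` is an involution of the signed set `S` that reverses all signs. -/
def IsSignReversingInvolution (S : SignedSet) (f : S.carrier → S.carrier) : Prop :=
  (∀ x, f (f x) = x) ∧ ∀ x, S.sign (f x) = - S.sign x

/-- A pair of graphs. Exactly one graph of each pair below has an edge out of node `1`; it is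
always listed first (and called `A`), which makes the unordered pair `{A, B}` an ordered one. -/
abbrev GraphPair (n : ℕ) : Type := ColoredGraph n × ColoredGraph n

/-- The pairs in `S₁`. -/
structure IsPairOne {n : ℕ} (A B : ColoredGraph n) : Prop where
  outA : HasOutEdgesExactlyOff A {0}
  outB : HasOutEdgesExactlyOff B {0, 1, 2}
  cycleA : ∀ C, IsCycle A C → ∃ c, EdgesOutOfHaveColor A C c
  cycleB : ∀ C, IsCycle B C → ∃ c, EdgesOutOfHaveColor B C c
  redA : ∀ e ∈ A, e.color = EdgeColor.red → ∃ C, IsCycle A C ∧ e.src ∈ C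
  redB : ∀ e ∈ B, e.color = EdgeColor.red → ∃ C, IsCycle B C ∧ e.src ∈ C

/-- The pairs in `S₂`; here the forbidden meta-cycle also counts as a cycle. -/
structure IsPairTwo {n : ℕ} (A B : ColoredGraph n) : Prop where
  outA : HasOutEdgesExactlyOff A {0, 2}
  outB : HasOutEdgesExactlyOff B {0, 1}
  cycleA : ∀ C, IsCycle A C → ∃ c, EdgesOutOfHaveColor A C c
  cycleB : ∀ C, IsCycle B C → ∃ c, EdgesOutOfHaveColor B C c
  cycleMeta : HasForbiddenMetaCycle A B → ∃ c, MetaCycleHasColor A B c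
  redA : ∀ e ∈ A, e.color = EdgeColor.red →
    (∃ C, IsCycle A C ∧ e.src ∈ C) ∨ (HasForbiddenMetaCycle A B ∧ e.src ∈ metaEdge A 1 2)
  redB : ∀ e ∈ B, e.color = EdgeColor.red →
    (∃ C, IsCycle B C ∧ e.src ∈ C) ∨ (HasForbiddenMetaCycle A B ∧ e.src ∈ metaEdge B 2 1)

/-- The signed set `S₁`: a pair is positive if its number of red cycles is even. -/
noncomputable def SOne (n : ℕ) : SignedSet where
  carrier := {P : GraphPair n // IsPairOne P.1 P.2}
  sign P := (-1) ^ (numRedCycles P.1.1 + numRedCycles P.1.2)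

/-- The signed set `S₂`: a pair is positive if its number of red cycles is even, where the
forbidden meta-cycle counts as a single cycle. -/
noncomputable def STwo (n : ℕ) : SignedSet where
  carrier := {P : GraphPair n // IsPairTwo P.1 P.2}
  sign P := (-1) ^ (numRedCycles P.1.1 + numRedCycles P.1.2 + numRedMetaCycles P.1.1 P.1.2)

/-- The pair of graphs underlying an element of `S₁ - S₂`. -/
def toPair {n : ℕ} (x : (SOne n - STwo n).carrier) : GraphPair n :=
  Sum.elim (fun P : (SOne n).carrier => P.1) (fun P : (STwo n).carrier => P.1) x

/-- In the crabwalk graph of `(A, B)` the red edges of `A` are dark and those of `B` are light. -/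
inductive Shade where
  | dark
  | light

/-- An edge `src → tgt` of the crabwalk graph, with its shade. -/
structure CrabEdge (n : ℕ) where
  shade : Shade
  src : Fin (n + 1)
  tgt : Fin (n + 1)

/-- The node reached by traveling along the edge: dark edges are traveled forward and light edges
backward. -/
def CrabEdge.arrival {n : ℕ} (e : CrabEdge n) : Fin (n + 1) :=
  match e.shade with
  | Shade.dark => e.tgt
  | Shade.light => e.src

/-- `CrabStep A B e e'`: the crabwalk that has just traveled along `e` has not reached node `1`
or `2`, and it next travels along `e'`. -/
inductive CrabStep {n : ℕ} (A B : ColoredGraph n) : CrabEdge n → CrabEdge n → Prop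
  /-- At a node `x` with a light edge into it, switch from dark to light. -/
  | darkLight (u x v : Fin (n + 1)) : RedAdj A u x → x ≠ 1 → x ≠ 2 → RedAdj B v x →
      CrabStep A B ⟨Shade.dark, u, x⟩ ⟨Shade.light, v, x⟩
  /-- At a node `x` with no light edge into it, continue forward along the dark edge. -/
  | darkDark (u x y : Fin (n + 1)) : RedAdj A u x → x ≠ 1 → x ≠ 2 → (¬ ∃ v, RedAdj B v x) →
      RedAdj A x y → CrabStep A B ⟨Shade.dark, u, x⟩ ⟨Shade.dark, x, y⟩
  /-- At a node `x` with a dark edge out of it, switch from light to dark. -/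
  | lightDark (x t y : Fin (n + 1)) : RedAdj B x t → x ≠ 1 → x ≠ 2 → RedAdj A x y →
      CrabStep A B ⟨Shade.light, x, t⟩ ⟨Shade.dark, x, y⟩
  /-- At a node `x` with no dark edge out of it, continue backward along the light edge. -/
  | lightLight (x t w : Fin (n + 1)) : RedAdj B x t → x ≠ 1 → x ≠ 2 → (¬ ∃ y, RedAdj A x y) →
      RedAdj B w x → CrabStep A B ⟨Shade.light, x, t⟩ ⟨Shade.light, w, x⟩

/-- `w` is the list of edges traveled by a completed crabwalk: it starts with the dark edge out of
node `1` and ends on reaching node `1` or node `2`. -/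
def IsCrabwalk {n : ℕ} (A B : ColoredGraph n) (w : List (CrabEdge n)) : Prop :=
  (∃ x, RedAdj A 1 x ∧ w.head? = some ⟨Shade.dark, 1, x⟩) ∧
  w.IsChain (CrabStep A B) ∧
  ∃ e, w.getLast? = some e ∧ (e.arrival = 1 ∨ e.arrival = 2)

/-- The interior nodes of the dark meta-edges traveled by `w`. -/
def darkInterior {n : ℕ} (w : List (CrabEdge n)) : Set (Fin (n + 1)) :=
  {x | ∃ u y, [(⟨Shade.dark, u, x⟩ : CrabEdge n), ⟨Shade.dark, x, y⟩] <:+: w}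

/-- The interior nodes of the light meta-edges traveled by `w`. -/
def lightInterior {n : ℕ} (w : List (CrabEdge n)) : Set (Fin (n + 1)) :=
  {x | ∃ t u, [(⟨Shade.light, x, t⟩ : CrabEdge n), ⟨Shade.light, u, x⟩] <:+: w}

/-- The edges of `A` that move to `B`: the dark edges traveled, and the black edges of `A` out of
the interior nodes of the light meta-edges, which move from `B` to `A`. -/
def movedFromA {n : ℕ} (A : ColoredGraph n) (w : List (CrabEdge n)) : Set (Edge n) :=
  {e | e ∈ A ∧ ((e.color = EdgeColor.red ∧ ⟨Shade.dark, e.src, e.tgt⟩ ∈ w) ∨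
    (e.color = EdgeColor.black ∧ e.src ∈ lightInterior w))}

/-- The edges of `B` that move to `A`: the light edges traveled, and the black edges of `B` out of
the interior nodes of the dark meta-edges, which move from `A` to `B`. -/
def movedFromB {n : ℕ} (B : ColoredGraph n) (w : List (CrabEdge n)) : Set (Edge n) :=
  {e | e ∈ B ∧ ((e.color = EdgeColor.red ∧ ⟨Shade.light, e.src, e.tgt⟩ ∈ w) ∨
    (e.color = EdgeColor.black ∧ e.src ∈ darkInterior w))}

/-- `A` becomes `C` and `B` becomes `D` when the edge `e` moves from `A` to `B`. The result is
listed as `(D, C)`, because now `D` has the edge out of node `1`. -/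
def moveEdge {n : ℕ} (P : GraphPair n) (e : Edge n) : GraphPair n :=
  (P.2 ∪ {e}, P.1 \ {e})

/-- `A` becomes `C` and `B` becomes `D` when the edges designated by the crabwalk `w` are moved.
The result is listed as `(D, C)`, because now `D` has the edge out of node `1`. -/
def moveCrabwalk {n : ℕ} (P : GraphPair n) (w : List (CrabEdge n)) : GraphPair n :=
  ((P.2 \ movedFromB P.2 w) ∪ movedFromA P.1 w, (P.1 \ movedFromA P.1 w) ∪ movedFromB P.2 w)

/-- The rule `φ₁` turns the pair `P` into the pair `Q`: a black edge out of node `1` is moved to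
the other graph; if the edge out of node `1` is red, the crabwalk is performed. -/
def PhiOneRule {n : ℕ} (P Q : GraphPair n) : Prop :=
  (∃ x, (⟨1, x, EdgeColor.black⟩ : Edge n) ∈ P.1 ∧ Q = moveEdge P ⟨1, x, EdgeColor.black⟩) ∨
  (∃ w, IsCrabwalk P.1 P.2 w ∧ Q = moveCrabwalk P w)

end RedHotPotato

namespace RedHotPotato

/-! Give every node a slot in each graph. Only one slot of node 1 is in use, the one in `A`, and
only one slot of node 2, in the graph named by `o` (`A` for S₁, `B` for S₂). Red edges define a
self-map `next` of the slots: an edge lands at its endpoint in the same graph, except that at 1 and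
2 it lands in the slot in use. Given the out-edge conditions, membership in S₁ or S₂ means exactly
that `next` is a permutation (`IsPairOne.isBalanced`, `IsPairTwo.isBalanced`,
`IsBalanced.isPairOne`, `IsBalanced.isPairTwo`); the jumps at 1 and 2 turn a red forbidden
meta-cycle into one orbit. The orbits of red slots are the red cycles, so the parity of their number
is the sign of the permutation times (-1) to the number of red slots (`neg_one_pow_ncard_orbits`).

Both cases of φ₁ move all edges out of a set M of nodes: {1}, or the sources of the crabwalk. Since
the graphs are then relisted, it is the nodes outside M whose slots are exchanged. If N is a set
matching M along red edges (`Compatible`), the new permutation is `flip N * perm * flip M`, so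
balance persists and the parity changes by (-1)^(|M|+|N|). For the crabwalk N is the set of targets,
and |M|+|N| is odd exactly when 2 ∈ M, that is, when the walk ends by traveling a light edge
backward to 2 (`IsCrabwalk.neg_one_pow_card`). But 2 ∈ M is also the condition for the pair to stay
in its own set; otherwise it passes between S₁ and S₂ and the subtraction reverses the sign. So the
sign changes in every case.

The crabwalk ends because its step relation is injective and its first edge has no predecessor. The
map is an involution because the same list of edges is a crabwalk of the new pair
(`IsCrabwalk.swapOn`). -/

variable {n : ℕ}

/-! ### Slots and the map that follows red edges -/

/-- A node together with one of the two graphs of a pair (`true` for the first one). -/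
abbrev Slot (n : ℕ) : Type := Fin (n + 1) × Bool

/-- The first (`true`) or second (`false`) graph of a pair. -/
def side (P : GraphPair n) (s : Bool) : ColoredGraph n := cond s P.1 P.2

@[simp] theorem side_true (P : GraphPair n) : side P true = P.1 := rfl

@[simp] theorem side_false (P : GraphPair n) : side P false = P.2 := rfl

/-- The slot at which an edge of the graph `s` into `v` lands, where node `1` has its only slot
in the first graph and node `2` has its only slot in the graph `o`. -/
def landing (o : Bool) (v : Fin (n + 1)) (s : Bool) : Slot n :=
  (v, if v = 1 then true else if v = 2 then o else s)

/-- The slots out of which an edge comes, if node `2` has its slot in the graph `o`. -/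
def IsSlot (o : Bool) (p : Slot n) : Prop := p.1 ≠ 0 ∧ landing o p.1 p.2 = p

/-- There is a red edge out of the slot. -/
def RedSlot (P : GraphPair n) (p : Slot n) : Prop := ∃ v, RedAdj (side P p.2) p.1 v

open Classical in
/-- Follow the red edge out of a slot, if there is one. -/
noncomputable def next (P : GraphPair n) (o : Bool) (p : Slot n) : Slot n :=
  -- Slots without a red edge are fixed, so bijectivity of the map only constrains red edges.
  if h : RedSlot P p then landing o h.choose p.2 else p

/-- The local description of the pairs in `S₁` (`o = true`) and `S₂` (`o = false`). -/
structure IsBalanced (P : GraphPair n) (o : Bool) : Prop where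
  no_loop : ∀ s, ∀ e ∈ side P s, e.src ≠ e.tgt
  isSlot : ∀ s, ∀ e ∈ side P s, IsSlot o (e.src, s)
  exists_edge : ∀ s u, IsSlot o (u, s) → ∃ e ∈ side P s, e.src = u
  unique : ∀ s, ∀ e ∈ side P s, ∀ e' ∈ side P s, e.src = e'.src → e = e'
  -- On the finite set of slots this amounts to bijectivity.
  surjective : Function.Surjective (next P o)

@[simp] theorem landing_fst (o : Bool) (v : Fin (n + 1)) (s : Bool) : (landing o v s).1 = v := rfl

theorem landing_of_ne {o : Bool} {v : Fin (n + 1)} {s : Bool} (h1 : v ≠ 1) (h2 : v ≠ 2) :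
    landing o v s = (v, s) := by
  simp [landing, h1, h2]

theorem next_of_not_redSlot {P : GraphPair n} {o : Bool} {p : Slot n} (h : ¬ RedSlot P p) :
    next P o p = p := dif_neg h

theorem next_of_unique {P : GraphPair n} {o s : Bool} {u v : Fin (n + 1)}
    (hu : ∀ e ∈ side P s, ∀ e' ∈ side P s, e.src = e'.src → e = e')
    (h : RedAdj (side P s) u v) : next P o (u, s) = landing o v s := by
  have hr : RedSlot P (u, s) := ⟨v, h⟩
  rw [next, dif_pos hr]
  have := hu _ hr.choose_spec _ h rfl
  simp only [Edge.mk.injEq] at this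
  rw [this.2.1]

theorem EdgeColor.eq_red_of_ne_black {c : EdgeColor} (h : c ≠ EdgeColor.black) :
    c = EdgeColor.red := by
  cases c
  · exact absurd rfl h
  · rfl

/-- Surjectivity of `next` only has to be checked at red slots. -/
theorem next_surjective_of {P : GraphPair n} {o : Bool}
    (hu : ∀ s, ∀ e ∈ side P s, ∀ e' ∈ side P s, e.src = e'.src → e = e')
    (h : ∀ s v, RedSlot P (v, s) → ∃ t u, RedAdj (side P t) u v ∧ landing o v t = (v, s)) :
    Function.Surjective (next P o) := by
  rintro ⟨v, s⟩
  by_cases hr : RedSlot P (v, s)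
  · obtain ⟨t, u, hut, hl⟩ := h s v hr
    exact ⟨(u, t), (next_of_unique (hu t) hut).trans hl⟩
  · exact ⟨_, next_of_not_redSlot hr⟩

/-! ### Propagation of red along paths and cycles -/

namespace IsBalanced

variable {P : GraphPair n} {o : Bool}

theorem injective (h : IsBalanced P o) : Function.Injective (next P o) :=
  Finite.injective_iff_surjective.2 h.surjective

theorem next_eq (h : IsBalanced P o) {s : Bool} {u v : Fin (n + 1)}
    (hr : RedAdj (side P s) u v) : next P o (u, s) = landing o v s :=
  next_of_unique (h.unique s) hr

theorem isSlot_of_redSlot (h : IsBalanced P o) {p : Slot n} (hp : RedSlot P p) : IsSlot o p :=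
  h.isSlot _ _ hp.choose_spec

theorem landing_of_adj (h : IsBalanced P o) {s : Bool} {u v : Fin (n + 1)}
    (ha : Adj (side P s) u v) : landing o u s = (u, s) :=
  (h.isSlot _ _ ha.choose_spec).2

theorem color_eq_red (h : IsBalanced P o) {s : Bool} {e : Edge n} (he : e ∈ side P s)
    (hr : RedSlot P (e.src, s)) : e.color = EdgeColor.red := by
  rw [h.unique s e he _ hr.choose_spec rfl]

theorem redAdj_of_adj (h : IsBalanced P o) {s : Bool} {u v : Fin (n + 1)}
    (ha : Adj (side P s) u v) (hr : RedSlot P (u, s)) : RedAdj (side P s) u v := by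
  obtain ⟨c, hc⟩ := ha
  have := h.color_eq_red hc hr
  simp only at this
  subst this
  exact hc

theorem adj_unique (h : IsBalanced P o) {s : Bool} {u v w : Fin (n + 1)}
    (ha : Adj (side P s) u v) (hb : Adj (side P s) u w) : v = w := by
  have := h.unique s _ ha.choose_spec _ hb.choose_spec rfl
  simp only [Edge.mk.injEq] at this
  exact this.2.1

/-- A landing slot that is not red would be fixed by `next`, so by injectivity it would be the slot
the edge comes from, and the edge would be a loop. -/
theorem redSlot_landing (h : IsBalanced P o) {s : Bool} {u v : Fin (n + 1)}
    (hr : RedAdj (side P s) u v) : RedSlot P (landing o v s) := by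
  by_contra hn
  have h1 := h.injective ((next_of_not_redSlot hn).trans (h.next_eq hr).symm)
  exact h.no_loop s _ hr (congrArg Prod.fst h1).symm

theorem exists_red_pred (h : IsBalanced P o) {s : Bool} {v : Fin (n + 1)}
    (hr : RedSlot P (v, s)) : ∃ t u, RedAdj (side P t) u v ∧ landing o v t = (v, s) := by
  obtain ⟨⟨u, t⟩, hq⟩ := h.surjective (v, s)
  by_cases hn : RedSlot P (u, t)
  · obtain ⟨w, hw⟩ := hn
    rw [h.next_eq hw] at hq
    obtain rfl : w = v := congrArg Prod.fst hq
    exact ⟨t, u, hw, hq⟩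
  · rw [next_of_not_redSlot hn] at hq
    exact absurd (hq ▸ hr) hn

theorem redSlot_of_reach (h : IsBalanced P o) {s : Bool} {u v : Fin (n + 1)}
    (hr : RedSlot P (u, s)) (huv : Relation.ReflTransGen (Adj (side P s)) u v) :
    RedSlot P (landing o v s) := by
  induction huv with
  | refl => rwa [(h.isSlot_of_redSlot hr).2]
  | tail _ hbc ih =>
    rw [h.landing_of_adj hbc] at ih
    exact h.redSlot_landing (h.redAdj_of_adj hbc ih)

theorem color_eq_red_of_reach (h : IsBalanced P o) {s : Bool} {u : Fin (n + 1)} {e : Edge n}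
    (hr : RedSlot P (u, s)) (he : e ∈ side P s)
    (hue : Relation.ReflTransGen (Adj (side P s)) u e.src) : e.color = EdgeColor.red :=
  h.color_eq_red he ((h.isSlot s e he).2 ▸ h.redSlot_of_reach hr hue)

theorem transGen_back (h : IsBalanced P o) {s : Bool} {v w : Fin (n + 1)}
    (hv : Relation.TransGen (Adj (side P s)) v v)
    (hw : Relation.ReflTransGen (Adj (side P s)) v w) :
    Relation.TransGen (Adj (side P s)) w v := by
  induction hw with
  | refl => exact hv
  | tail _ hbc ih =>
    obtain ⟨d, hbd, hd⟩ := Relation.TransGen.head'_iff.1 ih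
    rw [h.adj_unique hbd hbc] at hd
    exact hv.trans_right hd

theorem exists_adj_of_isCycle {G : ColoredGraph n} {C : Set (Fin (n + 1))} (hC : IsCycle G C)
    {v : Fin (n + 1)} (hv : v ∈ C) : ∃ u ∈ C, Adj G u v := by
  obtain ⟨w, hw, rfl⟩ := hC
  obtain ⟨u, hwu, huv⟩ := Relation.TransGen.tail'_iff.1 (hv : Relation.TransGen (Adj G) w v)
  exact ⟨u, hw.trans_left hwu, huv⟩

/-- Red propagates forward along edges, hence one red edge makes the whole cycle red. -/
theorem exists_cycle_color (h : IsBalanced P o) (s : Bool) (C : Set (Fin (n + 1)))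
    (hC : IsCycle (side P s) C) : ∃ c, EdgesOutOfHaveColor (side P s) C c := by
  obtain ⟨v, hv, rfl⟩ := hC
  by_cases hr : RedSlot P (v, s)
  · exact ⟨EdgeColor.red, fun e he hve => h.color_eq_red_of_reach hr he hve.to_reflTransGen⟩
  · refine ⟨EdgeColor.black, fun e he hve => ?_⟩
    by_contra hne
    apply hr
    have hred : RedSlot P (e.src, s) := by
      refine ⟨e.tgt, ?_⟩
      rw [RedAdj, ← EdgeColor.eq_red_of_ne_black hne]
      exact he
    obtain ⟨d, hd, -⟩ := Relation.TransGen.head'_iff.1 hv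
    rw [← h.landing_of_adj hd]
    exact h.redSlot_of_reach hred (h.transGen_back hv hve.to_reflTransGen).to_reflTransGen

/-! ### Reachability along red edges between slots -/

/-- One step along a red edge between slots. -/
def Step (P : GraphPair n) (o : Bool) (p q : Slot n) : Prop := RedSlot P p ∧ next P o p = q

/-- `Reach P o p q`: one comes from `p` to `q` along red edges. -/
abbrev Reach (P : GraphPair n) (o : Bool) : Slot n → Slot n → Prop :=
  Relation.ReflTransGen (Step P o)

theorem step_of_redAdj (h : IsBalanced P o) {s : Bool} {u v : Fin (n + 1)}
    (hr : RedAdj (side P s) u v) : Step P o (u, s) (landing o v s) :=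
  ⟨⟨v, hr⟩, h.next_eq hr⟩

theorem Step.exists_redAdj (h : IsBalanced P o) {s : Bool} {u : Fin (n + 1)} {q : Slot n}
    (hs : Step P o (u, s) q) : RedAdj (side P s) u q.1 ∧ landing o q.1 s = q := by
  obtain ⟨⟨v, hv⟩, hq⟩ := hs
  rw [h.next_eq hv] at hq
  subst hq
  exact ⟨hv, rfl⟩

theorem Step.redSlot (h : IsBalanced P o) {p q : Slot n} (hs : Step P o p q) : RedSlot P q := by
  obtain ⟨h1, h2⟩ := Step.exists_redAdj (u := p.1) (s := p.2) h hs
  exact h2 ▸ h.redSlot_landing h1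

theorem Reach.redSlot (h : IsBalanced P o) {p q : Slot n} (hp : RedSlot P p)
    (hpq : Reach P o p q) : RedSlot P q := by
  induction hpq with
  | refl => exact hp
  | tail _ hs _ => exact hs.redSlot h

theorem reach_iterate (h : IsBalanced P o) {p : Slot n} (hp : RedSlot P p) (k : ℕ) :
    Reach P o p ((next P o)^[k] p) := by
  induction k with
  | zero => exact Relation.ReflTransGen.refl
  | succ k ih =>
    rw [Function.iterate_succ_apply']
    exact ih.tail ⟨ih.redSlot h hp, rfl⟩

theorem Reach.exists_iterate {p q : Slot n} (hpq : Reach P o p q) :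
    ∃ k, (next P o)^[k] p = q := by
  induction hpq with
  | refl => exact ⟨0, rfl⟩
  | tail _ hs ih =>
    obtain ⟨k, hk⟩ := ih
    exact ⟨k + 1, by rw [Function.iterate_succ_apply', hk, hs.2]⟩

/-- An injective self-map of a finite set makes every point periodic; with period m + 1, iterating m
more times after the first step returns to the start. -/
theorem reach_next_self (h : IsBalanced P o) {p : Slot n} (hp : RedSlot P p) :
    Reach P o (next P o p) p := by
  obtain ⟨k, hk, hper⟩ := h.injective.mem_periodicPts p
  obtain ⟨m, rfl⟩ := Nat.exists_eq_succ_of_ne_zero hk.ne'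
  have : (next P o)^[m] (next P o p) = p := hper
  rw [← this, this]
  nth_rewrite 2 [← this]
  exact h.reach_iterate (Step.redSlot h ⟨hp, rfl⟩) m

theorem Reach.symm (h : IsBalanced P o) {p q : Slot n} (hpq : Reach P o p q) :
    Reach P o q p := by
  induction hpq with
  | refl => exact Relation.ReflTransGen.refl
  | tail _ hs ih =>
    refine Relation.ReflTransGen.trans ?_ ih
    rw [← hs.2]
    exact h.reach_next_self hs.1

/-- Going forward one stays in the same graph or leaves it through a node. -/
theorem Reach.forward (h : IsBalanced P o) {u : Fin (n + 1)} {s : Bool} {q : Slot n}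
    (hq : Reach P o (u, s) q) :
    (q.2 = s ∧ Relation.ReflTransGen (Adj (side P s)) u q.1) ∨
      ∃ x, landing o x s = (x, !s) ∧ Relation.TransGen (Adj (side P s)) u x ∧
        Reach P o (u, s) (x, !s) := by
  induction hq with
  | refl => exact Or.inl ⟨rfl, Relation.ReflTransGen.refl⟩
  | @tail b c hb hs ih =>
    rcases ih with ⟨h1, h2⟩ | ih
    · obtain ⟨b1, b2⟩ := b
      simp only at h1 h2
      subst h1
      obtain ⟨h3, h4⟩ := hs.exists_redAdj h
      by_cases hc : c.2 = b2
      · exact Or.inl ⟨hc, h2.tail ⟨_, h3⟩⟩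
      · have hc' : c = (c.1, !b2) := Prod.ext rfl (by revert hc; cases c.2 <;> cases b2 <;> simp)
        refine Or.inr ⟨c.1, h4.trans hc', Relation.TransGen.tail' h2 ⟨_, h3⟩, ?_⟩
        rw [← hc']
        exact hb.tail hs
    · exact Or.inr ih

/-- Going backward one stays in the same graph or one entered it through a node. -/
theorem Reach.backward (h : IsBalanced P o) {v : Fin (n + 1)} {s : Bool} {q : Slot n}
    (hq : Reach P o q (v, s)) :
    (q.2 = s ∧ Relation.ReflTransGen (Adj (side P s)) q.1 v) ∨
      ∃ x, landing o x (!s) = (x, s) ∧ Relation.ReflTransGen (Adj (side P s)) x v ∧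
        Reach P o (x, s) (v, s) := by
  induction hq using Relation.ReflTransGen.head_induction_on with
  | refl => exact Or.inl ⟨rfl, Relation.ReflTransGen.refl⟩
  | @head a c hs hc ih =>
    rcases ih with ⟨h1, h2⟩ | ih
    · obtain ⟨c1, c2⟩ := c
      obtain ⟨a1, a2⟩ := a
      simp only at h1 h2
      subst h1
      obtain ⟨h3, h4⟩ := hs.exists_redAdj h
      by_cases ha : a2 = c2
      · subst ha
        exact Or.inl ⟨rfl, h2.head ⟨_, h3⟩⟩
      · have ha' : a2 = !c2 := by revert ha; cases a2 <;> cases c2 <;> simp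
        subst ha'
        exact Or.inr ⟨c1, h4, h2, hc⟩
    · exact Or.inr ih

/-- The orbit of a red slot returns to it. If it never leaves the graph `s`, the return path is a
directed cycle of that graph. -/
theorem transGen_of_not_exit (h : IsBalanced P o) {u : Fin (n + 1)} {s : Bool}
    (hr : RedSlot P (u, s))
    (hx : ¬ ∃ x, landing o x s = (x, !s) ∧ Relation.TransGen (Adj (side P s)) u x ∧
        Reach P o (u, s) (x, !s)) : Relation.TransGen (Adj (side P s)) u u := by
  obtain ⟨v, hv⟩ := hr
  have h1 := h.step_of_redAdj hv
  have h2 : Reach P o (landing o v s) (u, s) := by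
    rw [← h.next_eq hv]
    exact h.reach_next_self ⟨v, hv⟩
  rcases Reach.forward h (Relation.ReflTransGen.single h1) with ⟨h3, -⟩ | h3
  · have h4 : landing o v s = (v, s) := Prod.ext rfl h3
    rw [h4] at h2 h1
    rcases Reach.forward h h2 with ⟨-, h5⟩ | ⟨x, h5, h6, h7⟩
    · exact Relation.TransGen.head' ⟨_, hv⟩ h5
    · exact absurd ⟨x, h5, h6.head ⟨_, hv⟩, h7.head h1⟩ hx
  · exact absurd h3 hx

end IsBalanced

/-! ### The special nodes and the slots in use -/

theorem one_ne_two (hn : 2 ≤ n) : (1 : Fin (n + 1)) ≠ 2 := by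
  obtain ⟨m, rfl⟩ := Nat.exists_eq_add_of_le' hn
  intro h
  have := congrArg Fin.val h
  simp [Nat.mod_eq_of_lt (show 2 < m + 2 + 1 by omega)] at this

theorem one_ne_zero' (hn : 2 ≤ n) : (1 : Fin (n + 1)) ≠ 0 := by
  obtain ⟨m, rfl⟩ := Nat.exists_eq_add_of_le' hn
  intro h
  have := congrArg Fin.val h
  simp at this

theorem two_ne_zero' (hn : 2 ≤ n) : (2 : Fin (n + 1)) ≠ 0 := by
  obtain ⟨m, rfl⟩ := Nat.exists_eq_add_of_le' hn
  intro h
  have := congrArg Fin.val h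
  simp [Nat.mod_eq_of_lt (show 2 < m + 2 + 1 by omega)] at this

@[simp] theorem landing_one (o s : Bool) : landing o (1 : Fin (n + 1)) s = (1, true) := by
  simp [landing]

theorem landing_two (hn : 2 ≤ n) (o s : Bool) : landing o (2 : Fin (n + 1)) s = (2, o) := by
  simp [landing, (one_ne_two hn).symm]

theorem isSlot_one_true (u : Fin (n + 1)) :
    IsSlot true (u, true) ↔ u ∉ ({0} : Set (Fin (n + 1))) := by
  simp [IsSlot, landing]

theorem isSlot_one_false (u : Fin (n + 1)) :
    IsSlot true (u, false) ↔ u ∉ ({0, 1, 2} : Set (Fin (n + 1))) := by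
  simp only [IsSlot, landing]
  by_cases h1 : u = 1 <;> by_cases h2 : u = 2 <;> simp [h1, h2]

theorem isSlot_two_true (hn : 2 ≤ n) (u : Fin (n + 1)) :
    IsSlot false (u, true) ↔ u ∉ ({0, 2} : Set (Fin (n + 1))) := by
  simp only [IsSlot, landing]
  by_cases h1 : u = 1
  · simp [h1, one_ne_two hn]
  · by_cases h2 : u = 2 <;> simp [h1, h2, (one_ne_two hn).symm]

theorem isSlot_two_false (u : Fin (n + 1)) :
    IsSlot false (u, false) ↔ u ∉ ({0, 1} : Set (Fin (n + 1))) := by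
  simp only [IsSlot, landing]
  by_cases h1 : u = 1 <;> by_cases h2 : u = 2 <;> simp [h1, h2]

/-- This and the next two lemmas locate the crossings between the graphs: for S₁ none from `A` to
`B`; for S₂ only node 2 from `A` to `B`, and only node 1 from `B` to `A`. -/
theorem exit_true_true (x : Fin (n + 1)) : landing true x true ≠ (x, !true) := by
  simp [landing]

theorem exit_false_true {x : Fin (n + 1)} (h : landing false x true = (x, false)) : x = 2 := by
  by_contra h2
  simp [landing, h2] at h

theorem exit_false_false {x : Fin (n + 1)} (h : landing false x false = (x, true)) : x = 1 := by
  by_contra h2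
  simp [landing, h2] at h

/-! ### Pairs in S₁ and S₂ are balanced -/

theorem HasOutEdgesExactlyOff.unique {G : ColoredGraph n} {U : Set (Fin (n + 1))}
    (h : HasOutEdgesExactlyOff G U) : ∀ e ∈ G, ∀ e' ∈ G, e.src = e'.src → e = e' := by
  intro e he e' he' hs
  exact (h.2.2 e.src (h.2.1 e he)).unique ⟨he, rfl⟩ ⟨he', hs.symm⟩

theorem HasOutEdgesExactlyOff.isBalanced {P : GraphPair n} {o : Bool} {U : Bool → Set (Fin (n + 1))}
    (hU : ∀ s u, IsSlot o (u, s) ↔ u ∉ U s)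
    (h : ∀ s, HasOutEdgesExactlyOff (side P s) (U s))
    (hs : Function.Surjective (next P o)) : IsBalanced P o where
  no_loop s := (h s).1
  isSlot s e he := (hU s _).2 ((h s).2.1 e he)
  exists_edge s u hu := ((h s).2.2 u ((hU s u).1 hu)).exists
  unique s := (h s).unique
  surjective := hs

theorem IsBalanced.hasOutEdgesExactlyOff {P : GraphPair n} {o s : Bool} {U : Set (Fin (n + 1))}
    (h : IsBalanced P o) (hU : ∀ u, IsSlot o (u, s) ↔ u ∉ U) :
    HasOutEdgesExactlyOff (side P s) U := by
  refine ⟨h.no_loop s, fun e he => (hU _).1 (h.isSlot s e he), fun v hv => ?_⟩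
  obtain ⟨e, he, hev⟩ := h.exists_edge s v ((hU v).2 hv)
  exact ⟨e, ⟨he, hev⟩, fun e' he' => h.unique s _ he'.1 _ he (he'.2.trans hev.symm)⟩

theorem EdgesOutOfHaveColor.eq_red {G : ColoredGraph n} {X : Set (Fin (n + 1))} {c : EdgeColor}
    (h : EdgesOutOfHaveColor G X c) {v w : Fin (n + 1)} (hv : v ∈ X) (hr : RedAdj G v w) :
    c = EdgeColor.red :=
  (h _ hr hv).symm

theorem EdgesOutOfHaveColor.redAdj {G : ColoredGraph n} {X : Set (Fin (n + 1))}
    (h : EdgesOutOfHaveColor G X EdgeColor.red) {v w : Fin (n + 1)} (hv : v ∈ X) (hr : Adj G v w) :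
    RedAdj G v w := by
  obtain ⟨c, hc⟩ := hr
  obtain rfl : c = EdgeColor.red := h _ hc hv
  exact hc

/-- A red edge on a monochromatic cycle is preceded by a red edge. -/
theorem exists_redAdj_of_isCycle {G : ColoredGraph n} {C : Set (Fin (n + 1))} (hC : IsCycle G C)
    (hc : ∃ c, EdgesOutOfHaveColor G C c) {v w : Fin (n + 1)} (hv : v ∈ C) (hr : RedAdj G v w) :
    ∃ u, RedAdj G u v := by
  obtain ⟨c, hc⟩ := hc
  obtain rfl := hc.eq_red hv hr
  obtain ⟨u, hu, huv⟩ := IsBalanced.exists_adj_of_isCycle hC hv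
  exact ⟨u, hc.redAdj hu huv⟩

theorem IsPairOne.isBalanced {P : GraphPair n} (h : IsPairOne P.1 P.2) : IsBalanced P true := by
  refine HasOutEdgesExactlyOff.isBalanced (U := fun s => cond s {0} {0, 1, 2}) ?_ ?_ ?_
  · rintro (_ | _) u
    · exact isSlot_one_false u
    · exact isSlot_one_true u
  · rintro (_ | _)
    · exact h.outB
    · exact h.outA
  · refine next_surjective_of ?_ ?_
    · rintro (_ | _)
      · exact h.outB.unique
      · exact h.outA.unique
    · rintro (_ | _) v ⟨w, hw⟩
      · obtain ⟨C, hC, hv⟩ := h.redB _ hw rfl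
        obtain ⟨u, hu⟩ := exists_redAdj_of_isCycle hC (h.cycleB C hC) hv hw
        exact ⟨false, u, hu, ((isSlot_one_false v).2 (h.outB.2.1 _ hw)).2⟩
      · obtain ⟨C, hC, hv⟩ := h.redA _ hw rfl
        obtain ⟨u, hu⟩ := exists_redAdj_of_isCycle hC (h.cycleA C hC) hv hw
        exact ⟨true, u, hu, ((isSlot_one_true v).2 (h.outA.2.1 _ hw)).2⟩

/-- A red edge on a meta-edge is preceded by a red edge. -/
theorem exists_redAdj_of_metaEdge {G : ColoredGraph n} {i j v : Fin (n + 1)}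
    (hc : EdgesOutOfHaveColor G (metaEdge G i j) EdgeColor.red) (hv : v ∈ metaEdge G i j)
    (hi : v ≠ i) : ∃ u, RedAdj G u v := by
  rcases Relation.ReflTransGen.cases_tail hv.1 with h | ⟨u, hu, huv⟩
  · exact absurd h hi
  · exact ⟨u, hc.redAdj ⟨hu, hv.2.head huv⟩ huv⟩

theorem exists_redAdj_end_of_metaEdge {G : ColoredGraph n} {i j : Fin (n + 1)}
    (hc : EdgesOutOfHaveColor G (metaEdge G i j) EdgeColor.red)
    (h : Relation.TransGen (Adj G) i j) : ∃ u, RedAdj G u j := by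
  obtain ⟨u, hu, huv⟩ := Relation.TransGen.tail'_iff.1 h
  exact ⟨u, hc.redAdj ⟨hu, Relation.TransGen.single huv⟩ huv⟩

/-- A red edge out of v lies on a red cycle or on the red meta-cycle and thus has a red predecessor
there. At the junctions 2 and 1 of the meta-cycle the predecessor lies in the other graph, which is
where `landing` changes graphs. -/
theorem IsPairTwo.isBalanced (hn : 2 ≤ n) {P : GraphPair n} (h : IsPairTwo P.1 P.2) :
    IsBalanced P false := by
  refine HasOutEdgesExactlyOff.isBalanced (U := fun s => cond s {0, 2} {0, 1}) ?_ ?_ ?_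
  · rintro (_ | _) u
    · exact isSlot_two_false u
    · exact isSlot_two_true hn u
  · rintro (_ | _)
    · exact h.outB
    · exact h.outA
  · refine next_surjective_of ?_ ?_
    · rintro (_ | _)
      · exact h.outB.unique
      · exact h.outA.unique
    · rintro (_ | _) v ⟨w, hw⟩
      · have hsv : landing false v false = (v, false) :=
          ((isSlot_two_false v).2 (h.outB.2.1 _ hw)).2
        rcases h.redB _ hw rfl with ⟨C, hC, hv⟩ | ⟨hF, hv⟩
        · obtain ⟨u, hu⟩ := exists_redAdj_of_isCycle hC (h.cycleB C hC) hv hw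
          exact ⟨false, u, hu, hsv⟩
        · obtain ⟨c, hcA, hcB⟩ := h.cycleMeta hF
          obtain rfl := hcB.eq_red hv hw
          by_cases h2 : v = 2
          · subst h2
            obtain ⟨u, hu⟩ := exists_redAdj_end_of_metaEdge hcA hF.1
            exact ⟨true, u, hu, landing_two hn _ _⟩
          · obtain ⟨u, hu⟩ := exists_redAdj_of_metaEdge hcB hv h2
            exact ⟨false, u, hu, hsv⟩
      · have hsv : landing false v true = (v, true) :=
          ((isSlot_two_true hn v).2 (h.outA.2.1 _ hw)).2
        rcases h.redA _ hw rfl with ⟨C, hC, hv⟩ | ⟨hF, hv⟩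
        · obtain ⟨u, hu⟩ := exists_redAdj_of_isCycle hC (h.cycleA C hC) hv hw
          exact ⟨true, u, hu, hsv⟩
        · obtain ⟨c, hcA, hcB⟩ := h.cycleMeta hF
          obtain rfl := hcA.eq_red hv hw
          by_cases h1 : v = 1
          · subst h1
            obtain ⟨u, hu⟩ := exists_redAdj_end_of_metaEdge hcB hF.2
            exact ⟨false, u, hu, landing_one _ _⟩
          · obtain ⟨u, hu⟩ := exists_redAdj_of_metaEdge hcA hv h1
            exact ⟨true, u, hu, hsv⟩

/-! ### Balanced pairs lie in S₁ or S₂ -/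

namespace IsBalanced

variable {P : GraphPair n} {o : Bool}

theorem redSlot_of_mem {P : GraphPair n} {s : Bool} {e : Edge n} (he : e ∈ side P s)
    (hc : e.color = EdgeColor.red) : RedSlot P (e.src, s) :=
  ⟨e.tgt, by rw [RedAdj, ← hc]; exact he⟩

theorem isCycle_of_transGen {G : ColoredGraph n} {v : Fin (n + 1)}
    (hv : Relation.TransGen (Adj G) v v) : ∃ C, IsCycle G C ∧ v ∈ C :=
  ⟨_, ⟨v, hv, rfl⟩, hv⟩

theorem reach_of_reach (h : IsBalanced P o) {s : Bool} {u v : Fin (n + 1)}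
    (hr : RedSlot P (u, s)) (huv : Relation.ReflTransGen (Adj (side P s)) u v) :
    Reach P o (u, s) (landing o v s) := by
  induction huv with
  | refl => rw [(h.isSlot_of_redSlot hr).2]
  | tail _ hbc ih =>
    rw [h.landing_of_adj hbc] at ih
    exact ih.tail (h.step_of_redAdj (h.redAdj_of_adj hbc (ih.redSlot h hr)))

/-- An orbit that changes graphs would have to change back, but for S₁ there is no crossing from the
first graph to the second. -/
theorem transGen_self_of_true (h : IsBalanced P true) {s : Bool} {u : Fin (n + 1)}
    (hr : RedSlot P (u, s)) : Relation.TransGen (Adj (side P s)) u u := by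
  refine h.transGen_of_not_exit hr ?_
  rintro ⟨x, hx, -, hux⟩
  cases s
  · rcases Reach.forward h (hux.symm h) with ⟨h1, -⟩ | ⟨y, hy, -⟩
    · simp at h1
    · exact exit_true_true y hy
  · exact exit_true_true x hx

theorem isPairOne (h : IsBalanced P true) : IsPairOne P.1 P.2 where
  outA := h.hasOutEdgesExactlyOff (s := true) isSlot_one_true
  outB := h.hasOutEdgesExactlyOff (s := false) isSlot_one_false
  cycleA := h.exists_cycle_color true
  cycleB := h.exists_cycle_color false
  redA _ he hc := isCycle_of_transGen
    (h.transGen_self_of_true (redSlot_of_mem (s := true) he hc))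
  redB _ he hc := isCycle_of_transGen
    (h.transGen_self_of_true (redSlot_of_mem (s := false) he hc))

theorem hasForbiddenMetaCycle_of_reach (h : IsBalanced P false)
    (h12 : Reach P false (1, true) (2, false)) : HasForbiddenMetaCycle P.1 P.2 := by
  constructor
  · rcases Reach.forward h h12 with ⟨h1, -⟩ | ⟨x, hx, hx', -⟩
    · simp at h1
    · rwa [exit_false_true hx] at hx'
  · rcases Reach.forward h (h12.symm h) with ⟨h1, -⟩ | ⟨x, hx, hx', -⟩
    · simp at h1
    · rwa [exit_false_false hx] at hx'

/-- If the orbit leaves the first graph, it does so at node 2, and it can only come back at node 1.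
The slot then lies on the red path from 1 to 2. -/
theorem cycle_or_meta_true (h : IsBalanced P false) {u : Fin (n + 1)}
    (hr : RedSlot P (u, true)) : Relation.TransGen (Adj P.1) u u ∨
      (Reach P false (1, true) (2, false) ∧ Reach P false (1, true) (u, true) ∧
        u ∈ metaEdge P.1 1 2) := by
  by_contra! hcon
  refine hcon.1 (h.transGen_of_not_exit hr ?_)
  rintro ⟨x, hx, hx', hux⟩
  obtain rfl := exit_false_true hx
  rcases Reach.backward h (hux.symm h) with ⟨h1, -⟩ | ⟨x, hy, hy', hxu⟩
  · simp at h1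
  · obtain rfl := exit_false_false hy
    exact hcon.2 (hxu.trans hux) hxu ⟨hy', hx'⟩

theorem cycle_or_meta_false (h : IsBalanced P false) {u : Fin (n + 1)}
    (hr : RedSlot P (u, false)) : Relation.TransGen (Adj P.2) u u ∨
      (Reach P false (1, true) (2, false) ∧ Reach P false (1, true) (u, false) ∧
        u ∈ metaEdge P.2 2 1) := by
  by_contra! hcon
  refine hcon.1 (h.transGen_of_not_exit hr ?_)
  rintro ⟨x, hx, hx', hux⟩
  obtain rfl := exit_false_false hx
  rcases Reach.backward h (hux.symm h) with ⟨h1, -⟩ | ⟨x, hy, hy', hxu⟩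
  · simp at h1
  · obtain rfl := exit_false_true hy
    exact hcon.2 (Reach.symm h (hxu.trans hux)) (hux.symm h) ⟨hy', hx'⟩

theorem metaCycleHasColor_red (hn : 2 ≤ n) (h : IsBalanced P false)
    (hF : HasForbiddenMetaCycle P.1 P.2) (hr : RedSlot P (1, true)) :
    MetaCycleHasColor P.1 P.2 EdgeColor.red := by
  have h2 : RedSlot P (2, false) := by
    rw [← landing_two hn false true]
    exact h.redSlot_of_reach (s := true) hr hF.1.to_reflTransGen
  exact ⟨fun e he hve => h.color_eq_red_of_reach (s := true) hr he hve.1,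
    fun e he hve => h.color_eq_red_of_reach (s := false) h2 he hve.1⟩

theorem isPairTwo (hn : 2 ≤ n) (h : IsBalanced P false) : IsPairTwo P.1 P.2 where
  outA := h.hasOutEdgesExactlyOff (s := true) (isSlot_two_true hn)
  outB := h.hasOutEdgesExactlyOff (s := false) isSlot_two_false
  cycleA := h.exists_cycle_color true
  cycleB := h.exists_cycle_color false
  cycleMeta hF := by
    by_cases hr : RedSlot P (1, true)
    · exact ⟨_, h.metaCycleHasColor_red hn hF hr⟩
    -- A red edge on the meta-cycle would propagate red forward to the slot of node 1.
    · refine ⟨EdgeColor.black, fun e he hve => ?_, fun e he hve => ?_⟩ <;> by_contra hc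
      · have h1 := redSlot_of_mem (s := true) he (EdgeColor.eq_red_of_ne_black hc)
        have h2 := h.redSlot_of_reach h1 hve.2.to_reflTransGen
        rw [landing_two hn] at h2
        have h3 := h.redSlot_of_reach h2 hF.2.to_reflTransGen
        rw [landing_one] at h3
        exact hr h3
      · have h1 := redSlot_of_mem (s := false) he (EdgeColor.eq_red_of_ne_black hc)
        have h2 := h.redSlot_of_reach h1 hve.2.to_reflTransGen
        rw [landing_one] at h2
        exact hr h2
  redA _ he hc := (h.cycle_or_meta_true (redSlot_of_mem (s := true) he hc)).imp
    isCycle_of_transGen fun hm => ⟨h.hasForbiddenMetaCycle_of_reach hm.1, hm.2.2⟩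
  redB _ he hc := (h.cycle_or_meta_false (redSlot_of_mem (s := false) he hc)).imp
    isCycle_of_transGen fun hm => ⟨h.hasForbiddenMetaCycle_of_reach hm.1, hm.2.2⟩

end IsBalanced

/-! ### Orbits and the sign of the permutation -/

namespace IsBalanced

variable {P : GraphPair n} {o : Bool}

/-- The permutation of the slots that follows the red edges. -/
noncomputable def perm (h : IsBalanced P o) : Equiv.Perm (Slot n) :=
  Equiv.ofBijective (next P o) ⟨h.injective, h.surjective⟩

@[simp] theorem perm_apply (h : IsBalanced P o) (p : Slot n) : h.perm p = next P o p := rfl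

theorem next_ne_iff (h : IsBalanced P o) (p : Slot n) : next P o p ≠ p ↔ RedSlot P p := by
  constructor
  · intro hp
    by_contra hr
    exact hp (next_of_not_redSlot hr)
  · rintro ⟨v, hv⟩ he
    rw [h.next_eq hv] at he
    exact h.no_loop _ _ hv (congrArg Prod.fst he).symm

theorem sameCycle_iff (h : IsBalanced P o) {p q : Slot n} (hp : RedSlot P p) :
    h.perm.SameCycle p q ↔ Reach P o p q := by
  have hpow : ∀ k : ℕ, (h.perm ^ k) p = (next P o)^[k] p := by
    intro k
    rw [Equiv.Perm.coe_pow]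
    rfl
  constructor
  · intro hs
    obtain ⟨k, hk⟩ := hs.exists_nat_pow_eq
    rw [← hk, hpow]
    exact h.reach_iterate hp k
  · intro hr
    obtain ⟨k, hk⟩ := Reach.exists_iterate hr
    exact ⟨k, by rw [zpow_natCast, hpow, hk]⟩

/-- The slots reached from a slot along red edges. -/
def orbit (P : GraphPair n) (o : Bool) (p : Slot n) : Set (Slot n) := {q | Reach P o p q}

/-- The orbits of the red slots. -/
def orbits (P : GraphPair n) (o : Bool) : Set (Set (Slot n)) :=
  {O | ∃ p, RedSlot P p ∧ O = orbit P o p}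

open Classical in
-- The orbits of red slots are the supports of the cycle factors, and a factor is determined by its
-- support.
theorem ncard_orbits (h : IsBalanced P o) : (orbits P o).ncard = h.perm.cycleType.card := by
  have hs : ∀ p, RedSlot P p → ((h.perm.cycleOf p).support : Set (Slot n)) = orbit P o p := by
    intro p hp
    ext q
    rw [Finset.mem_coe, Equiv.Perm.mem_support_cycleOf_iff' ((h.next_ne_iff p).2 hp),
      h.sameCycle_iff hp]
    rfl
  have hmem : ∀ p, p ∈ h.perm.support ↔ RedSlot P p := by
    intro p
    rw [Equiv.Perm.mem_support]
    exact h.next_ne_iff p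
  have hc : ∀ c ∈ h.perm.cycleFactorsFinset, ∃ p ∈ c.support, RedSlot P p := by
    intro c hc
    obtain ⟨p, hp⟩ := (Equiv.Perm.mem_cycleFactorsFinset_iff.1 hc).1.nonempty_support
    exact ⟨p, hp, (hmem p).1 (Equiv.Perm.mem_cycleFactorsFinset_support_le hc hp)⟩
  have himg : orbits P o = (fun c : Equiv.Perm (Slot n) => (c.support : Set (Slot n))) ''
      (h.perm.cycleFactorsFinset : Set (Equiv.Perm (Slot n))) := by
    ext O
    constructor
    · rintro ⟨p, hp, rfl⟩
      exact ⟨h.perm.cycleOf p, Equiv.Perm.cycleOf_mem_cycleFactorsFinset_iff.2 ((hmem p).2 hp),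
        hs p hp⟩
    · rintro ⟨c, hcm, rfl⟩
      obtain ⟨p, hp, hr⟩ := hc c hcm
      refine ⟨p, hr, ?_⟩
      rw [← hs p hr, ← Equiv.Perm.cycle_is_cycleOf hp hcm]
  rw [himg, Set.InjOn.ncard_image, Set.ncard_coe_finset, Equiv.Perm.cycleType_def,
    Multiset.card_map, Finset.card_def]
  intro c hcm d hdm hcd
  obtain ⟨p, hp, -⟩ := hc c hcm
  have hp' : p ∈ d.support := by
    have : p ∈ (c.support : Set (Slot n)) := hp
    rw [show (c.support : Set (Slot n)) = d.support from hcd] at this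
    exact this
  rw [Equiv.Perm.cycle_is_cycleOf hp hcm, ← Equiv.Perm.cycle_is_cycleOf hp' hdm]

/-- The number of red slots. -/
noncomputable def numRedSlots (P : GraphPair n) : ℕ := {p | RedSlot P p}.ncard

/-- The sign of a permutation is (-1) to the size of its support plus its number of nontrivial
cycles, and here the support is the set of red slots. -/
theorem neg_one_pow_ncard_orbits (h : IsBalanced P o) :
    (-1 : ℤˣ) ^ (orbits P o).ncard = Equiv.Perm.sign h.perm * (-1) ^ numRedSlots P := by
  classical
  have hcard : numRedSlots P = h.perm.support.card := by
    rw [numRedSlots, ← Set.ncard_coe_finset]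
    congr 1
    ext p
    rw [Finset.mem_coe, Equiv.Perm.mem_support]
    exact (h.next_ne_iff p).symm
  rw [Equiv.Perm.sign_of_cycleType, Equiv.Perm.sum_cycleType, h.ncard_orbits, hcard, pow_add,
    mul_right_comm, ← pow_add, ← two_mul, pow_mul]
  simp

theorem orbit_eq_of_reach (h : IsBalanced P o) {p q : Slot n} (hpq : Reach P o p q) :
    orbit P o p = orbit P o q := by
  ext r
  exact ⟨fun hr => (hpq.symm h).trans hr, fun hr => hpq.trans hr⟩

/-! ### Orbits as red cycles -/

/-- The red cycles of a graph. -/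
def redCycles (G : ColoredGraph n) : Set (Set (Fin (n + 1))) :=
  {C | IsCycle G C ∧ EdgesOutOfHaveColor G C EdgeColor.red}

/-- Every node of the cycle has an edge out of it in the graph `s`, so landing there never changes
the graph. -/
theorem orbit_of_transGen (h : IsBalanced P o) {s : Bool} {u : Fin (n + 1)}
    (hr : RedSlot P (u, s)) (hu : Relation.TransGen (Adj (side P s)) u u) :
    orbit P o (u, s) = (fun v => (v, s)) '' {w | Relation.TransGen (Adj (side P s)) u w} := by
  have hslot : ∀ w, Relation.TransGen (Adj (side P s)) u w → landing o w s = (w, s) := by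
    intro w hw
    obtain ⟨d, hd, -⟩ := Relation.TransGen.head'_iff.1 (h.transGen_back hu hw.to_reflTransGen)
    exact h.landing_of_adj hd
  ext q
  constructor
  · intro hq
    rcases Reach.forward h hq with ⟨h1, h2⟩ | ⟨x, hx, hux, -⟩
    · exact ⟨q.1, hu.trans_left h2, Prod.ext rfl h1.symm⟩
    · rw [hslot x hux] at hx
      simp at hx
  · rintro ⟨w, hw, rfl⟩
    have := h.reach_of_reach hr hw.to_reflTransGen
    rwa [hslot w hw] at this

theorem image_mem_orbits (h : IsBalanced P o) {s : Bool} {C : Set (Fin (n + 1))}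
    (hC : C ∈ redCycles (side P s)) : (fun v => (v, s)) '' C ∈ orbits P o := by
  obtain ⟨⟨v, hv, rfl⟩, hc⟩ := hC
  obtain ⟨d, hd, -⟩ := Relation.TransGen.head'_iff.1 hv
  have hr : RedSlot P (v, s) := ⟨d, hc.redAdj hv hd⟩
  exact ⟨(v, s), hr, (h.orbit_of_transGen hr hv).symm⟩

theorem orbit_mem_image (h : IsBalanced P o) {s : Bool} {u : Fin (n + 1)}
    (hr : RedSlot P (u, s)) (hu : Relation.TransGen (Adj (side P s)) u u) :
    orbit P o (u, s) ∈ Set.image (fun v => (v, s)) '' redCycles (side P s) :=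
  ⟨_, ⟨⟨u, hu, rfl⟩, fun _ he hve => h.color_eq_red_of_reach hr he hve.to_reflTransGen⟩,
    (h.orbit_of_transGen hr hu).symm⟩

theorem ncard_pure_orbits :
    (Set.image (fun v => (v, true)) '' redCycles P.1 ∪
      Set.image (fun v => (v, false)) '' redCycles P.2).ncard =
      numRedCycles P.1 + numRedCycles P.2 := by
  rw [Set.ncard_union_eq, Set.ncard_image_of_injective, Set.ncard_image_of_injective]
  · rfl
  · exact Set.image_injective.2 fun a b hab => congrArg Prod.fst hab
  · exact Set.image_injective.2 fun a b hab => congrArg Prod.fst hab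
  · rw [Set.disjoint_left]
    rintro _ ⟨C, ⟨⟨v, hv, rfl⟩, -⟩, rfl⟩ ⟨D, -, hD⟩
    have : (v, true) ∈ (fun v => (v, false)) '' D := by
      rw [hD]
      exact ⟨v, hv, rfl⟩
    obtain ⟨w, -, hw⟩ := this
    simp at hw

theorem ncard_orbits_one (h : IsBalanced P true) :
    (orbits P true).ncard = numRedCycles P.1 + numRedCycles P.2 := by
  rw [← ncard_pure_orbits]
  congr 1
  apply Set.Subset.antisymm
  · rintro _ ⟨⟨u, _ | _⟩, hr, rfl⟩
    · exact Or.inr (h.orbit_mem_image hr (h.transGen_self_of_true hr))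
    · exact Or.inl (h.orbit_mem_image hr (h.transGen_self_of_true hr))
  · rintro _ (⟨C, hC, rfl⟩ | ⟨C, hC, rfl⟩)
    · exact h.image_mem_orbits (s := true) hC
    · exact h.image_mem_orbits (s := false) hC

theorem redMeta_iff (hn : 2 ≤ n) (h : IsBalanced P false) :
    (HasForbiddenMetaCycle P.1 P.2 ∧ MetaCycleHasColor P.1 P.2 EdgeColor.red) ↔
      (RedSlot P (1, true) ∧ Reach P false (1, true) (2, false)) := by
  constructor
  · rintro ⟨hF, hc⟩
    obtain ⟨d, hd, -⟩ := Relation.TransGen.head'_iff.1 hF.1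
    have hr : RedSlot P (1, true) := ⟨d, hc.1.redAdj ⟨Relation.ReflTransGen.refl, hF.1⟩ hd⟩
    refine ⟨hr, ?_⟩
    have := h.reach_of_reach hr hF.1.to_reflTransGen
    rwa [landing_two hn] at this
  · rintro ⟨hr, h12⟩
    have hF := h.hasForbiddenMetaCycle_of_reach h12
    exact ⟨hF, h.metaCycleHasColor_red hn hF hr⟩

theorem ncard_orbits_two (hn : 2 ≤ n) (h : IsBalanced P false) :
    (orbits P false).ncard =
      numRedCycles P.1 + numRedCycles P.2 + numRedMetaCycles P.1 P.2 := by
  have hsub : Set.image (fun v => (v, true)) '' redCycles P.1 ∪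
      Set.image (fun v => (v, false)) '' redCycles P.2 ⊆ orbits P false := by
    rintro _ (⟨C, hC, rfl⟩ | ⟨C, hC, rfl⟩)
    · exact h.image_mem_orbits (s := true) hC
    · exact h.image_mem_orbits (s := false) hC
  have hsup : ∀ p, RedSlot P p → orbit P false p ∈
      (Set.image (fun v => (v, true)) '' redCycles P.1 ∪
        Set.image (fun v => (v, false)) '' redCycles P.2) ∨
      (Reach P false (1, true) (2, false) ∧ Reach P false (1, true) p) := by
    rintro ⟨u, _ | _⟩ hr
    · rcases h.cycle_or_meta_false hr with hu | hu
      · exact Or.inl (Or.inr (h.orbit_mem_image hr hu))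
      · exact Or.inr ⟨hu.1, hu.2.1⟩
    · rcases h.cycle_or_meta_true hr with hu | hu
      · exact Or.inl (Or.inl (h.orbit_mem_image hr hu))
      · exact Or.inr ⟨hu.1, hu.2.1⟩
  rw [← ncard_pure_orbits, numRedMetaCycles]
  split_ifs with hm
  · obtain ⟨hr, h12⟩ := (h.redMeta_iff hn).1 hm
    rw [← Set.ncard_insert_of_notMem (a := orbit P false (1, true))]
    · congr 1
      apply Set.Subset.antisymm
      · rintro _ ⟨p, hp, rfl⟩
        rcases hsup p hp with h1 | ⟨-, h1⟩
        · exact Or.inr h1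
        · exact Or.inl (h.orbit_eq_of_reach h1).symm
      · exact Set.insert_subset ⟨_, hr, rfl⟩ hsub
    -- The orbit of the meta-cycle meets both graphs, so it is not the orbit of a cycle in a single
    -- graph.
    · have hm1 : ((1, true) : Slot n) ∈ orbit P false (1, true) := Relation.ReflTransGen.refl
      have hm2 : ((2, false) : Slot n) ∈ orbit P false (1, true) := h12
      rintro (⟨C, -, hC⟩ | ⟨C, -, hC⟩)
      · rw [← hC] at hm2
        obtain ⟨w, -, hw⟩ := hm2
        simp at hw
      · rw [← hC] at hm1
        obtain ⟨w, -, hw⟩ := hm1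
        simp at hw
  · rw [add_zero]
    congr 1
    refine Set.Subset.antisymm ?_ hsub
    rintro _ ⟨p, hp, rfl⟩
    rcases hsup p hp with h1 | ⟨h12, h1⟩
    · exact h1
    · exact absurd ((h.redMeta_iff hn).2 ⟨Reach.redSlot h hp (h1.symm h), h12⟩) hm

end IsBalanced

/-! ### Moving edges and its effect on the permutation -/

/-- The edges out of the nodes in `M` are moved to the other graph, after which the two graphs
are listed in the other order. -/
def swapOn (M : Finset (Fin (n + 1))) (P : GraphPair n) : GraphPair n :=
  ({e | e ∈ P.1 ∧ e.src ∈ M} ∪ {e | e ∈ P.2 ∧ e.src ∉ M},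
    {e | e ∈ P.2 ∧ e.src ∈ M} ∪ {e | e ∈ P.1 ∧ e.src ∉ M})

/-- The graph of `P` from which the edge out of `u` in the graph `s` of `swapOn M P` comes. -/
def flipSide (M : Finset (Fin (n + 1))) (u : Fin (n + 1)) (s : Bool) : Bool :=
  if u ∈ M then s else !s

theorem flipSide_of_mem {M : Finset (Fin (n + 1))} {u : Fin (n + 1)} (h : u ∈ M) (s : Bool) :
    flipSide M u s = s := if_pos h

theorem flipSide_of_notMem {M : Finset (Fin (n + 1))} {u : Fin (n + 1)} (h : u ∉ M) (s : Bool) :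
    flipSide M u s = !s := if_neg h

@[simp] theorem flipSide_flipSide (M : Finset (Fin (n + 1))) (u : Fin (n + 1)) (s : Bool) :
    flipSide M u (flipSide M u s) = s := by
  by_cases h : u ∈ M <;> simp [flipSide, h]

theorem flipSide_congr {M N : Finset (Fin (n + 1))} {u v : Fin (n + 1)} (h : u ∈ M ↔ v ∈ N)
    (s : Bool) : flipSide M u s = flipSide N v s := by
  simp [flipSide, h]

theorem mem_side_swapOn {M : Finset (Fin (n + 1))} {P : GraphPair n} {s : Bool} {e : Edge n} :
    e ∈ side (swapOn M P) s ↔ e ∈ side P (flipSide M e.src s) := by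
  by_cases h : e.src ∈ M <;> cases s <;> simp [swapOn, side, flipSide, h]

theorem redAdj_swapOn {M : Finset (Fin (n + 1))} {P : GraphPair n} {s : Bool}
    {u v : Fin (n + 1)} :
    RedAdj (side (swapOn M P) s) u v ↔ RedAdj (side P (flipSide M u s)) u v :=
  mem_side_swapOn

theorem swapOn_swapOn (M : Finset (Fin (n + 1))) (P : GraphPair n) :
    swapOn M (swapOn M P) = P := by
  have h : ∀ s, side (swapOn M (swapOn M P)) s = side P s := by
    intro s
    ext e
    rw [mem_side_swapOn, mem_side_swapOn, flipSide_flipSide]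
  exact Prod.ext (h true) (h false)

/-- The permutation of the slots that exchanges the two slots of each node outside `M`. -/
def flip (M : Finset (Fin (n + 1))) : Equiv.Perm (Slot n) :=
  Equiv.prodCongrRight fun u => if u ∈ M then 1 else Equiv.boolNot

theorem flip_apply (M : Finset (Fin (n + 1))) (u : Fin (n + 1)) (s : Bool) :
    flip M (u, s) = (u, flipSide M u s) := by
  by_cases h : u ∈ M <;> simp [flip, flipSide, h]

@[simp] theorem flip_flip (M : Finset (Fin (n + 1))) (p : Slot n) : flip M (flip M p) = p := by
  obtain ⟨u, s⟩ := p
  rw [flip_apply, flip_apply, flipSide_flipSide]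

/-- There is one transposition for each of the n + 1 - |M| nodes outside `M`. -/
theorem sign_flip (M : Finset (Fin (n + 1))) :
    Equiv.Perm.sign (flip M) = (-1) ^ (n + 1) * (-1) ^ M.card := by
  have h : ∀ u : Fin (n + 1), Equiv.Perm.sign (if u ∈ M then 1 else Equiv.boolNot) =
      (-1) * (if u ∈ M then -1 else 1 : ℤˣ) := by
    intro u
    split_ifs
    · simp
    · decide
  rw [flip, Equiv.Perm.sign_prodCongrRight, Finset.prod_congr rfl fun u _ => h u,
    Finset.prod_mul_distrib, Finset.prod_ite_mem]
  simp

theorem redSlot_swapOn {M : Finset (Fin (n + 1))} {P : GraphPair n} {p : Slot n} :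
    RedSlot (swapOn M P) p ↔ RedSlot P (flip M p) := by
  obtain ⟨u, s⟩ := p
  simp only [RedSlot, flip_apply, redAdj_swapOn]

/-- The graph with an edge out of node `2` after `swapOn M`. -/
def newOwner (M : Finset (Fin (n + 1))) (o : Bool) : Bool := flipSide M 2 o

/-- The edges out of the nodes in `M` and the red edges into the nodes in `N` are the same, as far
as this makes sense. -/
structure Compatible (P : GraphPair n) (M N : Finset (Fin (n + 1))) : Prop where
  one_mem_left : 1 ∈ M
  one_mem_right : 1 ∈ N
  two_mem_iff : 2 ∈ M ↔ 2 ∈ N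
  black : ∀ p, ¬ RedSlot P p → (p.1 ∈ M ↔ p.1 ∈ N)
  red : ∀ s u v, RedAdj (side P s) u v → v ≠ 1 → v ≠ 2 → (u ∈ M ↔ v ∈ N)

/-- Node 1 lies in `N`, so its slot is not flipped; the slot of node 2 is flipped exactly when its
owner changes. Only the other nodes need the hypothesis on `t`. -/
theorem landing_newOwner (hn : 2 ≤ n) {M N : Finset (Fin (n + 1))} (h1 : 1 ∈ N)
    (h2 : 2 ∈ M ↔ 2 ∈ N) {v : Fin (n + 1)} {s t : Bool} (o : Bool)
    (h : v ≠ 1 → v ≠ 2 → t = flipSide N v s) :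
    landing (newOwner M o) v t = flip N (landing o v s) := by
  by_cases hv1 : v = 1
  · subst hv1
    rw [landing_one, landing_one, flip_apply, flipSide_of_mem h1]
  · by_cases hv2 : v = 2
    · subst hv2
      rw [landing_two hn, landing_two hn, flip_apply, newOwner, flipSide_congr h2]
    · rw [landing_of_ne hv1 hv2, landing_of_ne hv1 hv2, flip_apply, h hv1 hv2]

theorem isSlot_newOwner (hn : 2 ≤ n) {M : Finset (Fin (n + 1))} (h1 : 1 ∈ M) {o : Bool}
    {u : Fin (n + 1)} {s : Bool} :
    IsSlot (newOwner M o) (u, s) ↔ IsSlot o (u, flipSide M u s) := by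
  have h := landing_newOwner hn h1 Iff.rfl (v := u) (s := flipSide M u s) (t := s) o
    fun _ _ => (flipSide_flipSide M u s).symm
  simp only [IsSlot]
  rw [h, ← (flip M).injective.eq_iff, flip_flip, flip_apply]

namespace IsBalanced

variable {P : GraphPair n} {o : Bool} {M N : Finset (Fin (n + 1))}

theorem swapOn_unique (h : IsBalanced P o) (s : Bool) : ∀ e ∈ side (swapOn M P) s,
    ∀ e' ∈ side (swapOn M P) s, e.src = e'.src → e = e' := by
  intro e he e' he' hs
  rw [mem_side_swapOn] at he he'
  rw [← hs] at he'
  exact h.unique _ e he e' he' hs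

/-- Source slots are relabeled by `flip M` and landing slots by `flip N`. Compatibility makes the
two relabelings agree along each red edge and at slots that are not red. -/
theorem next_swapOn (hn : 2 ≤ n) (h : IsBalanced P o) (hc : Compatible P M N) (p : Slot n) :
    next (swapOn M P) (newOwner M o) p = flip N (next P o (flip M p)) := by
  by_cases hp : RedSlot P (flip M p)
  · obtain ⟨u, s⟩ := p
    obtain ⟨v, hv⟩ := hp
    rw [flip_apply M u s] at hv ⊢
    rw [h.next_eq hv, next_of_unique (h.swapOn_unique s) (redAdj_swapOn.2 hv)]
    refine landing_newOwner hn hc.one_mem_right hc.two_mem_iff o fun h1 h2 => ?_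
    rw [← flipSide_congr (hc.red _ _ _ hv h1 h2), flipSide_flipSide]
  · rw [next_of_not_redSlot hp, next_of_not_redSlot (mt redSlot_swapOn.1 hp)]
    obtain ⟨u, s⟩ := p
    have h1 := hc.black _ hp
    rw [flip_apply M u s] at h1 ⊢
    rw [flip_apply, ← flipSide_congr h1, flipSide_flipSide]

theorem swapOn (hn : 2 ≤ n) (h : IsBalanced P o) (hc : Compatible P M N) :
    IsBalanced (swapOn M P) (newOwner M o) where
  no_loop _ e he := h.no_loop _ e (mem_side_swapOn.1 he)
  isSlot _ e he := (isSlot_newOwner hn hc.one_mem_left).2 (h.isSlot _ e (mem_side_swapOn.1 he))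
  exists_edge s u hu := by
    obtain ⟨e, he, rfl⟩ := h.exists_edge _ u ((isSlot_newOwner hn hc.one_mem_left).1 hu)
    exact ⟨e, mem_side_swapOn.2 he, rfl⟩
  unique s := h.swapOn_unique s
  surjective p := by
    obtain ⟨q, hq⟩ := h.surjective (flip N p)
    exact ⟨flip M q, by rw [h.next_swapOn hn hc, flip_flip, hq, flip_flip]⟩

theorem perm_swapOn (hn : 2 ≤ n) (h : IsBalanced P o) (hc : Compatible P M N) :
    (h.swapOn hn hc).perm = flip N * h.perm * flip M :=
  Equiv.ext (h.next_swapOn hn hc)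

theorem numRedSlots_swapOn (M : Finset (Fin (n + 1))) (P : GraphPair n) :
    numRedSlots (RedHotPotato.swapOn M P) = numRedSlots P := by
  rw [numRedSlots, numRedSlots, ← Set.ncard_image_of_injective _ (flip M).injective]
  congr 1
  ext p
  simp only [Set.mem_image, Set.mem_ofPred_eq, redSlot_swapOn]
  constructor
  · rintro ⟨q, hq, rfl⟩
    exact hq
  · intro hp
    exact ⟨flip M p, by rwa [flip_flip], flip_flip M p⟩

/-- The number of red slots is unchanged, and the factors (-1)^(n+1) of the two flips cancel. -/
theorem neg_one_pow_ncard_orbits_swapOn (hn : 2 ≤ n) (h : IsBalanced P o)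
    (hc : Compatible P M N) :
    (-1 : ℤˣ) ^ (orbits (RedHotPotato.swapOn M P) (newOwner M o)).ncard =
      (-1) ^ (orbits P o).ncard * (-1) ^ (M.card + N.card) := by
  have hsq : ((-1 : ℤˣ) ^ (n + 1)) * (-1) ^ (n + 1) = 1 := by
    rw [← mul_pow]
    simp
  rw [(h.swapOn hn hc).neg_one_pow_ncard_orbits, h.neg_one_pow_ncard_orbits, h.perm_swapOn hn hc,
    Equiv.Perm.sign_mul, Equiv.Perm.sign_mul, sign_flip, sign_flip, numRedSlots_swapOn,
    pow_add _ M.card]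
  calc _ = ((-1 : ℤˣ) ^ (n + 1) * (-1) ^ (n + 1)) * (Equiv.Perm.sign h.perm *
        (-1) ^ numRedSlots P * ((-1) ^ M.card * (-1) ^ N.card)) := by
          simp only [mul_assoc, mul_comm, mul_left_comm]
    _ = _ := by rw [hsq, one_mul]

end IsBalanced

/-! ### Determinism and termination of the crabwalk -/

theorem isChain_succ {α : Type*} {R : α → α → Prop} {w : List α} (hw : w.IsChain R) {e : α}
    (he : e ∈ w) : w.getLast? = some e ∨ ∃ e', [e, e'] <:+: w ∧ R e e' := by
  obtain ⟨l₁, l₂, rfl⟩ := List.append_of_mem he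
  cases l₂ with
  | nil => simp
  | cons e' l =>
    have hi : [e, e'] <:+: l₁ ++ e :: e' :: l := ⟨l₁, l, by simp⟩
    exact Or.inr ⟨e', hi, by simpa using hw.infix hi⟩

theorem isChain_pred {α : Type*} {R : α → α → Prop} {w : List α} (hw : w.IsChain R) {e : α}
    (he : e ∈ w) : w.head? = some e ∨ ∃ e', [e', e] <:+: w ∧ R e' e := by
  obtain ⟨l₁, l₂, rfl⟩ := List.append_of_mem he
  rcases List.eq_nil_or_concat l₁ with rfl | ⟨l, e', rfl⟩
  · simp
  · have hi : [e', e] <:+: l ++ [e'] ++ e :: l₂ := ⟨l, l₂, by simp⟩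
    rw [List.concat_eq_append] at hw ⊢
    exact Or.inr ⟨e', hi, by simpa using hw.infix hi⟩

theorem mem_of_pair_infix {α : Type*} {a b : α} {w : List α} (h : [a, b] <:+: w) :
    a ∈ w ∧ b ∈ w :=
  ⟨h.subset (by simp), h.subset (by simp)⟩

/-- The crabwalk cannot go on after traveling along `e`. -/
def CrabEdge.IsFinal (e : CrabEdge n) : Prop := e.arrival = 1 ∨ e.arrival = 2

/-- `e` is an edge of the crabwalk graph of `P`. -/
def CrabEdge.IsIn (P : GraphPair n) (e : CrabEdge n) : Prop :=
  match e.shade with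
  | Shade.dark => RedAdj P.1 e.src e.tgt
  | Shade.light => RedAdj P.2 e.src e.tgt

theorem CrabStep.not_isFinal {A B : ColoredGraph n} {e e' : CrabEdge n} (h : CrabStep A B e e') :
    ¬ e.IsFinal := by
  cases h <;> simp_all [CrabEdge.IsFinal, CrabEdge.arrival]

theorem CrabStep.isIn_right {P : GraphPair n} {e e' : CrabEdge n}
    (h : CrabStep P.1 P.2 e e') : e'.IsIn P := by
  cases h <;> assumption

instance : Finite (CrabEdge n) := by
  refine Finite.of_injective (β := Prop × Fin (n + 1) × Fin (n + 1))
    (fun e => (e.shade = Shade.dark, e.src, e.tgt)) ?_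
  rintro ⟨_ | _, u, v⟩ ⟨_ | _, u', v'⟩ h <;> simp_all

namespace IsBalanced

variable {P : GraphPair n} {o : Bool}

theorem redAdj_src_unique (h : IsBalanced P o) {s : Bool} {u u' v : Fin (n + 1)}
    (hu : RedAdj (side P s) u v) (hu' : RedAdj (side P s) u' v) : u = u' :=
  congrArg Prod.fst (h.injective ((h.next_eq hu).trans (h.next_eq hu').symm))

theorem redAdj_tgt_unique (h : IsBalanced P o) {s : Bool} {u v v' : Fin (n + 1)}
    (hv : RedAdj (side P s) u v) (hv' : RedAdj (side P s) u v') : v = v' :=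
  h.adj_unique ⟨_, hv⟩ ⟨_, hv'⟩

theorem exists_redAdj_out (h : IsBalanced P o) {s : Bool} {u x : Fin (n + 1)} (h1 : x ≠ 1)
    (h2 : x ≠ 2) (hu : RedAdj (side P s) u x) : ∃ y, RedAdj (side P s) x y := by
  have := h.redSlot_landing hu
  rwa [landing_of_ne h1 h2] at this

theorem exists_redAdj_in (h : IsBalanced P o) {s : Bool} {x y : Fin (n + 1)} (h1 : x ≠ 1)
    (h2 : x ≠ 2) (hy : RedAdj (side P s) x y) : ∃ u, RedAdj (side P s) u x := by
  obtain ⟨t, u, hu, hl⟩ := h.exists_red_pred ⟨y, hy⟩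
  rw [landing_of_ne h1 h2] at hl
  obtain rfl : t = s := congrArg Prod.snd hl
  exact ⟨u, hu⟩

theorem ne_one_of_light (h : IsBalanced P o) {e : Edge n} (he : e ∈ P.2) : e.src ≠ 1 := by
  intro h1
  have := (h.isSlot false e he).2
  simp [h1] at this

theorem ne_two_of_mem_of_mem (hn : 2 ≤ n) (h : IsBalanced P o) {e e' : Edge n} (he : e ∈ P.1)
    (he' : e' ∈ P.2) (hs : e.src = e'.src) : e.src ≠ 2 := by
  intro h1
  have h2 := (h.isSlot true e he).2
  have h3 := (h.isSlot false e' he').2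
  rw [← hs, h1, landing_two hn] at h3
  rw [h1, landing_two hn] at h2
  simp_all

theorem crabStep_unique (h : IsBalanced P o) {e a b : CrabEdge n}
    (ha : CrabStep P.1 P.2 e a) (hb : CrabStep P.1 P.2 e b) : a = b := by
  cases ha with
  | darkLight u x v h1 h2 h3 h4 =>
    cases hb with
    | darkLight _ _ v' _ _ _ h4' => rw [h.redAdj_src_unique (s := false) h4 h4']
    | darkDark _ _ y _ _ _ h5 _ => exact absurd ⟨v, h4⟩ h5
  | darkDark u x y h1 h2 h3 h5 h6 =>
    cases hb with
    | darkLight _ _ v' _ _ _ h4' => exact absurd ⟨v', h4'⟩ h5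
    | darkDark _ _ y' _ _ _ _ h6' => rw [h.redAdj_tgt_unique (s := true) h6 h6']
  | lightDark x t y h1 h2 h3 h4 =>
    cases hb with
    | lightDark _ _ y' _ _ _ h4' => rw [h.redAdj_tgt_unique (s := true) h4 h4']
    | lightLight _ _ w' _ _ _ h5 _ => exact absurd ⟨y, h4⟩ h5
  | lightLight x t w h1 h2 h3 h5 h6 =>
    cases hb with
    | lightDark _ _ y' _ _ _ h4' => exact absurd ⟨y', h4'⟩ h5
    | lightLight _ _ w' _ _ _ _ h6' => rw [h.redAdj_src_unique (s := false) h6 h6']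

/-- Away from 1 and 2, a node has a red edge into it in a given graph exactly when it has one out of
it there. Hence two different rules leading to the same edge have contradictory conditions at the
node where they meet. -/
theorem crabStep_injective (h : IsBalanced P o) {e a b : CrabEdge n}
    (ha : CrabStep P.1 P.2 a e) (hb : CrabStep P.1 P.2 b e) : a = b := by
  cases ha with
  | darkLight u x v h1 h2 h3 h4 =>
    cases hb with
    | darkLight u' _ _ h1' _ _ _ => rw [h.redAdj_src_unique (s := true) h1 h1']
    | lightLight _ _ _ _ _ _ h5 _ =>
      exact absurd (h.exists_redAdj_out (s := true) h2 h3 h1) h5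
  | darkDark u x y h1 h2 h3 h5 h6 =>
    cases hb with
    | darkDark u' _ _ h1' _ _ _ _ => rw [h.redAdj_src_unique (s := true) h1 h1']
    | lightDark _ t _ h1' _ _ _ =>
      exact absurd (h.exists_redAdj_in (s := false) h2 h3 h1') h5
  | lightDark x t y h1 h2 h3 h4 =>
    cases hb with
    | darkDark u' _ _ h1' _ _ h5 _ =>
      exact absurd (h.exists_redAdj_in (s := false) h2 h3 h1) h5
    | lightDark _ t' _ h1' _ _ _ => rw [h.redAdj_tgt_unique (s := false) h1 h1']
  | lightLight x t w h1 h2 h3 h5 h6 =>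
    cases hb with
    | darkLight u' _ _ h1' _ _ _ =>
      exact absurd (h.exists_redAdj_out (s := true) h2 h3 h1') h5
    | lightLight _ t' _ h1' _ _ _ _ => rw [h.redAdj_tgt_unique (s := false) h1 h1']

theorem exists_crabStep (h : IsBalanced P o) {e : CrabEdge n} (he : e.IsIn P)
    (hf : ¬ e.IsFinal) : ∃ e', CrabStep P.1 P.2 e e' := by
  obtain ⟨_ | _, u, x⟩ := e
  · obtain ⟨h1, h2⟩ := not_or.1 hf
    by_cases hx : ∃ v, RedAdj P.2 v x
    · exact ⟨_, CrabStep.darkLight u x _ he h1 h2 hx.choose_spec⟩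
    · obtain ⟨y, hy⟩ := h.exists_redAdj_out (s := true) h1 h2 he
      exact ⟨_, CrabStep.darkDark u x y he h1 h2 hx hy⟩
  · obtain ⟨h1, h2⟩ := not_or.1 hf
    by_cases hx : ∃ y, RedAdj P.1 u y
    · exact ⟨_, CrabStep.lightDark u x _ he h1 h2 hx.choose_spec⟩
    · obtain ⟨y, hy⟩ := h.exists_redAdj_in (s := false) h1 h2 he
      exact ⟨_, CrabStep.lightLight u x y he h1 h2 hx hy⟩

theorem not_crabStep_start {A B : ColoredGraph n} {e : CrabEdge n} {x : Fin (n + 1)} :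
    ¬ CrabStep A B e ⟨Shade.dark, 1, x⟩ := by
  intro h
  cases h <;> simp_all

/-- The crabwalk ends. -/
theorem exists_isCrabwalk (h : IsBalanced P o) {x : Fin (n + 1)} (hx : RedAdj P.1 1 x) :
    ∃ w, IsCrabwalk P.1 P.2 w := by
  have hend : ∃ e, Relation.ReflTransGen (CrabStep P.1 P.2) ⟨Shade.dark, 1, x⟩ e ∧ e.IsFinal := by
    -- If no reachable edge were final, choosing successors would give an injective, hence
    -- surjective, self-map of the finite set of reachable edges, although the first edge has no
    -- predecessor.
    by_contra! hcon
    let X := {e : CrabEdge n // Relation.ReflTransGen (CrabStep P.1 P.2) ⟨Shade.dark, 1, x⟩ e}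
    have hin : ∀ e : X, e.1.IsIn P := by
      rintro ⟨e, he⟩
      rcases Relation.ReflTransGen.cases_tail he with rfl | ⟨a, -, ha⟩
      · exact hx
      · exact ha.isIn_right
    choose f hf using fun e : X => h.exists_crabStep (hin e) (hcon e.1 e.2)
    let g : X → X := fun e => ⟨f e, e.2.tail (hf e)⟩
    have hg : Function.Injective g := by
      intro a b hab
      have h1 := hf a
      rw [show f a = f b from congrArg Subtype.val hab] at h1
      exact Subtype.ext (h.crabStep_injective h1 (hf b))
    obtain ⟨a, ha⟩ := Finite.injective_iff_surjective.1 hg ⟨_, Relation.ReflTransGen.refl⟩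
    have h1 := hf a
    rw [show f a = _ from congrArg Subtype.val ha] at h1
    exact not_crabStep_start h1
  obtain ⟨e, he, hfin⟩ := hend
  obtain ⟨l, hl, hlast⟩ := List.exists_isChain_cons_of_relationReflTransGen he
  refine ⟨_, ⟨x, hx, rfl⟩, hl, e, ?_, hfin⟩
  rw [← hlast, List.getLast?_eq_getLast_of_ne_nil]

/-- Steps are deterministic and a final edge has no successor, so neither list can stop before the
other. -/
theorem crab_list_unique (h : IsBalanced P o) (l : List (CrabEdge n)) :
    ∀ (l' : List (CrabEdge n)) (e : CrabEdge n),
      (e :: l).IsChain (CrabStep P.1 P.2) → (e :: l').IsChain (CrabStep P.1 P.2) →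
      (∃ a, (e :: l).getLast? = some a ∧ a.IsFinal) →
      (∃ a, (e :: l').getLast? = some a ∧ a.IsFinal) → l = l' := by
  induction l with
  | nil =>
    rintro (_ | ⟨b, l'⟩) e - h2 ⟨a, ha, haf⟩ -
    · rfl
    · simp only [List.getLast?_singleton, Option.some.injEq] at ha
      subst ha
      exact absurd haf (List.isChain_cons_cons.1 h2).1.not_isFinal
  | cons c l ih =>
    rintro (_ | ⟨b, l'⟩) e h1 h2 ha ⟨a, ha', haf⟩
    · simp only [List.getLast?_singleton, Option.some.injEq] at ha'
      subst ha'
      exact absurd haf (List.isChain_cons_cons.1 h1).1.not_isFinal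
    · rw [List.isChain_cons_cons] at h1 h2
      obtain rfl := h.crabStep_unique h1.1 h2.1
      rw [List.getLast?_cons_cons] at ha ha'
      rw [ih l' c h1.2 h2.2 ha ⟨a, ha', haf⟩]

theorem isCrabwalk_unique (h : IsBalanced P o) {w w' : List (CrabEdge n)}
    (hw : IsCrabwalk P.1 P.2 w) (hw' : IsCrabwalk P.1 P.2 w') : w = w' := by
  obtain ⟨⟨x, hx, hh⟩, hc, hl⟩ := hw
  obtain ⟨⟨x', hx', hh'⟩, hc', hl'⟩ := hw'
  obtain rfl := h.redAdj_tgt_unique (s := true) hx hx'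
  cases w with
  | nil => simp at hh
  | cons e l =>
    cases w' with
    | nil => simp at hh'
    | cons e' l' =>
      simp only [List.head?_cons, Option.some.injEq] at hh hh'
      subst hh hh'
      rw [h.crab_list_unique l l' _ hc hc' hl hl']

end IsBalanced

/-! ### Sources and targets of the crabwalk -/

open Classical in
/-- The nodes out of which the edges in `w` come. -/
noncomputable def sources (w : List (CrabEdge n)) : Finset (Fin (n + 1)) :=
  Finset.univ.filter fun u => ∃ e ∈ w, e.src = u

open Classical in
/-- The nodes other than `1` and `2` into which the edges in `w` go, together with node `1`, and
with node `2` if it is a source. -/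
noncomputable def targets (w : List (CrabEdge n)) : Finset (Fin (n + 1)) :=
  Finset.univ.filter fun v =>
    (v ≠ 1 ∧ v ≠ 2 ∧ ∃ e ∈ w, e.tgt = v) ∨ v = 1 ∨ (v = 2 ∧ 2 ∈ sources w)

theorem mem_sources {w : List (CrabEdge n)} {u : Fin (n + 1)} :
    u ∈ sources w ↔ ∃ e ∈ w, e.src = u := by
  simp [sources]

theorem mem_targets_of_ne {w : List (CrabEdge n)} {v : Fin (n + 1)} (h1 : v ≠ 1) (h2 : v ≠ 2) :
    v ∈ targets w ↔ ∃ e ∈ w, e.tgt = v := by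
  simp [targets, h1, h2]

theorem one_mem_targets (w : List (CrabEdge n)) : 1 ∈ targets w := by
  simp [targets]

theorem two_mem_targets (hn : 2 ≤ n) {w : List (CrabEdge n)} :
    2 ∈ targets w ↔ 2 ∈ sources w := by
  simp [targets, (one_ne_two hn).symm]

/-- The crabwalk graph edge with the shade of the graph `s`. -/
def crabEdge (s : Bool) (u v : Fin (n + 1)) : CrabEdge n :=
  ⟨cond s Shade.dark Shade.light, u, v⟩

namespace IsCrabwalk

variable {P : GraphPair n} {o : Bool} {w : List (CrabEdge n)}

theorem isIn {A B : ColoredGraph n} (hw : IsCrabwalk A B w) {e : CrabEdge n} (he : e ∈ w) :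
    e.IsIn (A, B) := by
  rcases isChain_pred hw.2.1 he with hh | ⟨e', -, hs⟩
  · obtain ⟨x, hx, hx'⟩ := hw.1
    obtain rfl := Option.some.inj (hh.symm.trans hx')
    exact hx
  · exact CrabStep.isIn_right (P := (A, B)) hs

theorem exists_start {A B : ColoredGraph n} (hw : IsCrabwalk A B w) :
    ∃ x, RedAdj A 1 x ∧ (⟨Shade.dark, 1, x⟩ : CrabEdge n) ∈ w := by
  obtain ⟨x, hx, hx'⟩ := hw.1
  exact ⟨x, hx, List.mem_of_mem_head? hx'⟩

theorem one_mem_sources {A B : ColoredGraph n} (hw : IsCrabwalk A B w) : 1 ∈ sources w := by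
  obtain ⟨x, -, hx⟩ := hw.exists_start
  exact mem_sources.2 ⟨_, hx, rfl⟩

/-- Exactly one edge traveled is final. -/
theorem exists_isFinal {A B : ColoredGraph n} (hw : IsCrabwalk A B w) :
    ∃ e ∈ w, e.IsFinal ∧ ∀ e' ∈ w, e'.IsFinal → e' = e := by
  obtain ⟨e, he, hf⟩ := hw.2.2
  refine ⟨e, List.mem_of_getLast? he, hf, fun e' he' hf' => ?_⟩
  rcases isChain_succ hw.2.1 he' with h | ⟨a, -, ha⟩
  · exact Option.some.inj (h.symm.trans he)
  · exact absurd hf' ha.not_isFinal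

theorem exists_step {A B : ColoredGraph n} (hw : IsCrabwalk A B w) {e : CrabEdge n} (he : e ∈ w)
    (hf : ¬ e.IsFinal) : ∃ e', [e, e'] <:+: w ∧ CrabStep A B e e' := by
  rcases isChain_succ hw.2.1 he with h | h
  · obtain ⟨a, ha, haf⟩ := hw.2.2
    obtain rfl := Option.some.inj (h.symm.trans ha)
    exact absurd haf hf
  · exact h

theorem exists_step_to {A B : ColoredGraph n} (hw : IsCrabwalk A B w) {e : CrabEdge n}
    (he : e ∈ w) (hs : ∀ x, e ≠ ⟨Shade.dark, 1, x⟩) :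
    ∃ e', [e', e] <:+: w ∧ CrabStep A B e' e := by
  rcases isChain_pred hw.2.1 he with h | h
  · obtain ⟨x, -, hx⟩ := hw.1
    exact absurd (Option.some.inj (h.symm.trans hx)) (hs x)
  · exact h

theorem after_dark {A B : ColoredGraph n} (hw : IsCrabwalk A B w) {u x : Fin (n + 1)}
    (he : ⟨Shade.dark, u, x⟩ ∈ w) (h1 : x ≠ 1) (h2 : x ≠ 2) :
    (∃ v, RedAdj B v x ∧ ⟨Shade.light, v, x⟩ ∈ w) ∨
      ((¬ ∃ v, RedAdj B v x) ∧ ∃ y, ⟨Shade.dark, x, y⟩ ∈ w) := by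
  obtain ⟨e', hi, hs⟩ := hw.exists_step he (not_or.2 ⟨h1, h2⟩)
  have hm := (mem_of_pair_infix hi).2
  cases hs with
  | darkLight _ _ v _ _ _ h => exact Or.inl ⟨v, h, hm⟩
  | darkDark _ _ y _ _ _ h _ => exact Or.inr ⟨h, y, hm⟩

theorem after_light {A B : ColoredGraph n} (hw : IsCrabwalk A B w) {x t : Fin (n + 1)}
    (he : ⟨Shade.light, x, t⟩ ∈ w) (h1 : x ≠ 1) (h2 : x ≠ 2) :
    (∃ y, RedAdj A x y ∧ ⟨Shade.dark, x, y⟩ ∈ w) ∨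
      ((¬ ∃ y, RedAdj A x y) ∧ x ∈ lightInterior w ∧ ∃ v, ⟨Shade.light, v, x⟩ ∈ w) := by
  obtain ⟨e', hi, hs⟩ := hw.exists_step he (not_or.2 ⟨h1, h2⟩)
  have hm := (mem_of_pair_infix hi).2
  cases hs with
  | lightDark _ _ y _ _ _ h => exact Or.inl ⟨y, h, hm⟩
  | lightLight _ _ v _ _ _ h _ => exact Or.inr ⟨h, ⟨t, v, hi⟩, v, hm⟩

theorem before_dark (h : IsBalanced P o) (hw : IsCrabwalk P.1 P.2 w) {x y : Fin (n + 1)}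
    (he : ⟨Shade.dark, x, y⟩ ∈ w) (h1 : x ≠ 1) :
    x ≠ 2 ∧ ((∃ t, RedAdj P.2 x t ∧ ⟨Shade.light, x, t⟩ ∈ w) ∨
      ((¬ ∃ t, RedAdj P.2 x t) ∧ x ∈ darkInterior w ∧ ∃ u, ⟨Shade.dark, u, x⟩ ∈ w)) := by
  obtain ⟨e', hi, hs⟩ := hw.exists_step_to he (by rintro z hz; simp_all)
  have hm := (mem_of_pair_infix hi).1
  cases hs with
  | lightDark _ t _ h3 _ h2 _ => exact ⟨h2, Or.inl ⟨t, h3, hm⟩⟩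
  | darkDark u _ _ _ _ h2 h3 _ =>
    exact ⟨h2, Or.inr ⟨fun ⟨t, ht⟩ => h3 (h.exists_redAdj_in (s := false) h1 h2 ht),
      ⟨u, y, hi⟩, u, hm⟩⟩

theorem before_light {A B : ColoredGraph n} (hw : IsCrabwalk A B w) {v x : Fin (n + 1)}
    (he : ⟨Shade.light, v, x⟩ ∈ w) : x ≠ 1 ∧ x ≠ 2 ∧
      ((∃ u, RedAdj A u x ∧ ⟨Shade.dark, u, x⟩ ∈ w) ∨
        ((¬ ∃ y, RedAdj A x y) ∧ ∃ t, ⟨Shade.light, x, t⟩ ∈ w)) := by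
  obtain ⟨e', hi, hs⟩ := hw.exists_step_to he (by rintro z hz; simp_all)
  have hm := (mem_of_pair_infix hi).1
  cases hs with
  | darkLight u _ _ h3 h1 h2 _ => exact ⟨h1, h2, Or.inl ⟨u, h3, hm⟩⟩
  | lightLight _ t _ _ h1 h2 h3 _ => exact ⟨h1, h2, Or.inr ⟨h3, t, hm⟩⟩

/-- All red edges out of the sources are traveled. -/
theorem mem_of_src (hn : 2 ≤ n) (h : IsBalanced P o) (hw : IsCrabwalk P.1 P.2 w) {s : Bool}
    {x y : Fin (n + 1)} (hx : x ∈ sources w) (hr : RedAdj (side P s) x y) :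
    crabEdge s x y ∈ w := by
  obtain ⟨⟨_ | _, x, y'⟩, he, rfl⟩ := mem_sources.1 hx
  · have hin : RedAdj P.1 x y' := hw.isIn he
    cases s
    · rcases (before_dark h hw he (h.ne_one_of_light hr)).2 with ⟨t, ht, htm⟩ | ⟨hno, -⟩
      · obtain rfl := h.redAdj_tgt_unique (s := false) hr ht
        exact htm
      · exact absurd ⟨y, hr⟩ hno
    · obtain rfl := h.redAdj_tgt_unique (s := true) hr hin
      exact he
  · have hin : RedAdj P.2 x y' := hw.isIn he
    cases s
    · obtain rfl := h.redAdj_tgt_unique (s := false) hr hin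
      exact he
    · rcases hw.after_light he (h.ne_one_of_light hin) (h.ne_two_of_mem_of_mem hn hr hin rfl)
        with ⟨t, ht, htm⟩ | ⟨hno, -⟩
      · obtain rfl := h.redAdj_tgt_unique (s := true) hr ht
        exact htm
      · exact absurd ⟨y, hr⟩ hno

/-- All red edges into the targets are traveled. -/
theorem mem_of_tgt (h : IsBalanced P o) (hw : IsCrabwalk P.1 P.2 w) {s : Bool}
    {u x : Fin (n + 1)} (h1 : x ≠ 1) (h2 : x ≠ 2) (hx : x ∈ targets w)
    (hr : RedAdj (side P s) u x) : crabEdge s u x ∈ w := by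
  obtain ⟨⟨_ | _, u', x⟩, he, rfl⟩ := (mem_targets_of_ne h1 h2).1 hx
  · have hin : RedAdj P.1 u' x := hw.isIn he
    cases s
    · rcases hw.after_dark he h1 h2 with ⟨v, hv, hvm⟩ | ⟨hno, -⟩
      · obtain rfl := h.redAdj_src_unique (s := false) hr hv
        exact hvm
      · exact absurd ⟨u, hr⟩ hno
    · obtain rfl := h.redAdj_src_unique (s := true) hr hin
      exact he
  · have hin : RedAdj P.2 u' x := hw.isIn he
    cases s
    · obtain rfl := h.redAdj_src_unique (s := false) hr hin
      exact he
    · rcases (hw.before_light he).2.2 with ⟨v, hv, hvm⟩ | ⟨hno, -⟩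
      · obtain rfl := h.redAdj_src_unique (s := true) hr hv
        exact hvm
      · exact absurd (h.exists_redAdj_out (s := true) h1 h2 hr) hno

/-- If one slot of x is not red, x carries red edges in at most one graph, so the walk can only pass
straight through x, using both an edge into x and an edge out of it. -/
theorem mem_sources_iff_of_not_redSlot (h : IsBalanced P o) (hw : IsCrabwalk P.1 P.2 w)
    {s : Bool} {x : Fin (n + 1)} (h1 : x ≠ 1) (h2 : x ≠ 2) (hx : ¬ RedSlot P (x, s)) :
    x ∈ sources w ↔ x ∈ targets w := by
  have hnot : ∀ y t, RedAdj P.1 x y → RedAdj P.2 x t → False := by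
    intro y t hy ht
    cases s
    · exact hx ⟨t, ht⟩
    · exact hx ⟨y, hy⟩
  constructor
  · intro hs
    obtain ⟨⟨_ | _, x, y⟩, he, rfl⟩ := mem_sources.1 hs
    · have hin : RedAdj P.1 x y := hw.isIn he
      rcases (before_dark h hw he h1).2 with ⟨t, ht, -⟩ | ⟨-, -, u, hu⟩
      · exact (hnot y t hin ht).elim
      · exact (mem_targets_of_ne h1 h2).2 ⟨_, hu, rfl⟩
    · have hin : RedAdj P.2 x y := hw.isIn he
      rcases hw.after_light he h1 h2 with ⟨t, ht, -⟩ | ⟨-, -, u, hu⟩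
      · exact (hnot t y ht hin).elim
      · exact (mem_targets_of_ne h1 h2).2 ⟨_, hu, rfl⟩
  · intro ht
    obtain ⟨⟨_ | _, u, x⟩, he, rfl⟩ := (mem_targets_of_ne h1 h2).1 ht
    · have hin : RedAdj P.1 u x := hw.isIn he
      rcases hw.after_dark he h1 h2 with ⟨v, hv, -⟩ | ⟨-, y, hy⟩
      · obtain ⟨a, ha⟩ := h.exists_redAdj_out (s := true) h1 h2 hin
        obtain ⟨b, hb⟩ := h.exists_redAdj_out (s := false) h1 h2 hv
        exact (hnot a b ha hb).elim
      · exact mem_sources.2 ⟨_, hy, rfl⟩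
    · have hin : RedAdj P.2 u x := hw.isIn he
      rcases (hw.before_light he).2.2 with ⟨v, hv, -⟩ | ⟨-, y, hy⟩
      · obtain ⟨a, ha⟩ := h.exists_redAdj_out (s := true) h1 h2 hv
        obtain ⟨b, hb⟩ := h.exists_redAdj_out (s := false) h1 h2 hin
        exact (hnot a b ha hb).elim
      · exact mem_sources.2 ⟨_, hy, rfl⟩

theorem compatible (hn : 2 ≤ n) (h : IsBalanced P o) (hw : IsCrabwalk P.1 P.2 w) :
    Compatible P (sources w) (targets w) where
  one_mem_left := hw.one_mem_sources
  one_mem_right := one_mem_targets w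
  two_mem_iff := (two_mem_targets hn).symm
  black := by
    rintro ⟨x, s⟩ hp
    by_cases h1 : x = 1
    · subst h1
      exact iff_of_true hw.one_mem_sources (one_mem_targets w)
    · by_cases h2 : x = 2
      · subst h2
        exact (two_mem_targets hn).symm
      · exact mem_sources_iff_of_not_redSlot h hw h1 h2 hp
  red s u v hr h1 h2 :=
    ⟨fun hu => (mem_targets_of_ne h1 h2).2 ⟨_, mem_of_src hn h hw hu hr, rfl⟩,
      fun hv => mem_sources.2 ⟨_, mem_of_tgt h hw h1 h2 hv hr, rfl⟩⟩

theorem movedFromA_eq (hn : 2 ≤ n) (h : IsBalanced P o) (hw : IsCrabwalk P.1 P.2 w) :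
    movedFromA P.1 w = {e | e ∈ P.1 ∧ e.src ∈ sources w} := by
  ext ⟨u, v, c⟩
  refine and_congr_right fun he => ?_
  constructor
  · rintro (⟨-, hm⟩ | ⟨-, t, v, hi⟩)
    · exact mem_sources.2 ⟨_, hm, rfl⟩
    · exact mem_sources.2 ⟨_, (mem_of_pair_infix hi).1, rfl⟩
  · intro hu
    cases c with
    | red => exact Or.inl ⟨rfl, mem_of_src (s := true) hn h hw hu he⟩
    | black =>
      refine Or.inr ⟨rfl, ?_⟩
      -- The only edge of `A` out of u is black, so u is a source through a light edge, after which
      -- the walk must continue along a light edge.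
      have hno : ¬ ∃ y, RedAdj P.1 u y := by
        intro hr
        have := h.color_eq_red (s := true) he hr
        simp at this
      obtain ⟨⟨_ | _, u, y⟩, hem, rfl⟩ := mem_sources.1 hu
      · exact absurd ⟨y, hw.isIn hem⟩ hno
      · have hin : RedAdj P.2 u y := hw.isIn hem
        rcases hw.after_light hem (h.ne_one_of_light hin)
          (h.ne_two_of_mem_of_mem hn he hin rfl) with ⟨t, ht, -⟩ | ⟨-, hl, -⟩
        · exact absurd ⟨t, ht⟩ hno
        · exact hl

theorem movedFromB_eq (hn : 2 ≤ n) (h : IsBalanced P o) (hw : IsCrabwalk P.1 P.2 w) :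
    movedFromB P.2 w = {e | e ∈ P.2 ∧ e.src ∈ sources w} := by
  ext ⟨u, v, c⟩
  refine and_congr_right fun he => ?_
  constructor
  · rintro (⟨-, hm⟩ | ⟨-, t, v, hi⟩)
    · exact mem_sources.2 ⟨_, hm, rfl⟩
    · exact mem_sources.2 ⟨_, (mem_of_pair_infix hi).2, rfl⟩
  · intro hu
    cases c with
    | red => exact Or.inl ⟨rfl, mem_of_src (s := false) hn h hw hu he⟩
    | black =>
      refine Or.inr ⟨rfl, ?_⟩
      have hno : ¬ ∃ y, RedAdj P.2 u y := by
        intro hr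
        have := h.color_eq_red (s := false) he hr
        simp at this
      obtain ⟨⟨_ | _, u, y⟩, hem, rfl⟩ := mem_sources.1 hu
      · rcases (before_dark h hw hem (h.ne_one_of_light he)).2 with ⟨t, ht, -⟩ | ⟨-, hl, -⟩
        · exact absurd ⟨t, ht⟩ hno
        · exact hl
      · exact absurd ⟨y, hw.isIn hem⟩ hno

theorem moveCrabwalk_eq (hn : 2 ≤ n) (h : IsBalanced P o) (hw : IsCrabwalk P.1 P.2 w) :
    moveCrabwalk P w = swapOn (sources w) P := by
  rw [moveCrabwalk, movedFromA_eq hn h hw, movedFromB_eq hn h hw, swapOn]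
  refine Prod.ext ?_ ?_ <;> ext e <;>
    simp only [Set.mem_union, Set.mem_sdiff, Set.mem_ofPred_eq] <;> tauto

/-- Edges out of sources keep their shade: they are moved, and then the graphs are relisted. -/
theorem swapOn (h : IsBalanced P o) (hw : IsCrabwalk P.1 P.2 w) :
    IsCrabwalk (swapOn (sources w) P).1 (swapOn (sources w) P).2 w := by
  have key : ∀ {s : Bool} {u v : Fin (n + 1)}, u ∈ sources w →
      (RedAdj (side (RedHotPotato.swapOn (sources w) P) s) u v ↔ RedAdj (side P s) u v) := by
    intro s u v hu
    rw [redAdj_swapOn, flipSide_of_mem hu]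
  refine ⟨?_, hw.2.1.imp_of_mem_imp ?_, hw.2.2⟩
  · obtain ⟨x, hx, hx'⟩ := hw.1
    exact ⟨x, (key (s := true) hw.one_mem_sources).2 hx, hx'⟩
  · intro a b ha hb hab
    have ha' : a.src ∈ sources w := mem_sources.2 ⟨a, ha, rfl⟩
    have hb' : b.src ∈ sources w := mem_sources.2 ⟨b, hb, rfl⟩
    cases hab with
    | darkLight u x v h1 h2 h3 h4 =>
      exact CrabStep.darkLight u x v ((key (s := true) ha').2 h1) h2 h3
        ((key (s := false) hb').2 h4)
    | darkDark u x y h1 h2 h3 h4 h5 =>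
      refine CrabStep.darkDark u x y ((key (s := true) ha').2 h1) h2 h3 ?_
        ((key (s := true) hb').2 h5)
      -- A newly light edge into x would be a formerly dark one out of a node that is not a source,
      -- but the only dark edge into x comes from the source u.
      rintro ⟨v, hv⟩
      by_cases hm : v ∈ sources w
      · exact h4 ⟨v, (key (s := false) hm).1 hv⟩
      · have hv' := (redAdj_swapOn (s := false)).1 hv
        rw [flipSide_of_notMem hm] at hv'
        obtain rfl := h.redAdj_src_unique (s := true) h1 hv'
        exact hm ha'
    | lightDark x t y h1 h2 h3 h4 =>
      exact CrabStep.lightDark x t y ((key (s := false) ha').2 h1) h2 h3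
        ((key (s := true) hb').2 h4)
    | lightLight x t v h1 h2 h3 h4 h5 =>
      refine CrabStep.lightLight x t v ((key (s := false) ha').2 h1) h2 h3 ?_
        ((key (s := false) hb').2 h5)
      rintro ⟨y, hy⟩
      exact h4 ⟨y, (key (s := true) ha').1 hy⟩

/-- Within `D`, sources and targets both count the dark edges traveled, up to corrections at 1 and
2: node 1 is always a target, while a dark edge ending the walk at 1 or 2 is not counted by its
endpoint. -/
theorem card_filter_sources (hn : 2 ≤ n) (h : IsBalanced P o) (hw : IsCrabwalk P.1 P.2 w)
    (D : Finset (Fin (n + 1))) (hD : ∀ u, u ∈ D ↔ RedSlot P (u, true)) :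
    (targets w ∩ D).card = (sources w ∩ D).card + if 2 ∈ sources w then 1 else 0 := by
  classical
  let W : Finset (CrabEdge n) := w.toFinset.filter fun e => e.shade = Shade.dark
  have hW : ∀ e, e ∈ W ↔ e ∈ w ∧ e.shade = Shade.dark := by
    intro e
    simp [W]
  have hWadj : ∀ e ∈ W, RedAdj P.1 e.src e.tgt := by
    rintro ⟨_ | _, u, v⟩ he
    · exact hw.isIn ((hW _).1 he).1
    · simpa using ((hW _).1 he).2
  have hsrc : (W.image CrabEdge.src).card = W.card := by
    refine Finset.card_image_of_injOn fun a ha b hb hab => ?_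
    have h1 := hWadj a ha
    have h2 := hWadj b hb
    have h3 := ((hW a).1 ha).2.trans ((hW b).1 hb).2.symm
    rw [show b.src = a.src from hab.symm] at h2
    have h4 := h.redAdj_tgt_unique (s := true) h1 h2
    obtain ⟨_, _, _⟩ := a
    obtain ⟨_, _, _⟩ := b
    simp_all
  have htgt : (W.image CrabEdge.tgt).card = W.card := by
    refine Finset.card_image_of_injOn fun a ha b hb hab => ?_
    have h1 := hWadj a ha
    have h2 := hWadj b hb
    have h3 := ((hW a).1 ha).2.trans ((hW b).1 hb).2.symm
    rw [show b.tgt = a.tgt from hab.symm] at h2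
    have h4 := h.redAdj_src_unique (s := true) h1 h2
    obtain ⟨_, _, _⟩ := a
    obtain ⟨_, _, _⟩ := b
    simp_all
  have hS : sources w ∩ D = W.image CrabEdge.src := by
    ext u
    rw [Finset.mem_inter, Finset.mem_image, hD]
    constructor
    · rintro ⟨h1, v, hv⟩
      exact ⟨_, (hW _).2 ⟨mem_of_src (s := true) hn h hw h1 hv, rfl⟩, rfl⟩
    · rintro ⟨e, he, rfl⟩
      exact ⟨mem_sources.2 ⟨e, ((hW e).1 he).1, rfl⟩, _, hWadj e he⟩
  -- The walk starts at 1 and stops on reaching 2, so it never travels a dark edge out of 2.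
  have h2D : ¬ (2 ∈ sources w ∧ 2 ∈ D) := by
    rintro ⟨h2, h2'⟩
    obtain ⟨v, hv⟩ := (hD 2).1 h2'
    exact (before_dark h hw (mem_of_src (s := true) hn h hw h2 hv) (one_ne_two hn).symm).1 rfl
  have hT : targets w ∩ D = insert 1 ((W.image CrabEdge.tgt \ {1, 2})) := by
    ext v
    rw [Finset.mem_inter, Finset.mem_insert, Finset.mem_sdiff, Finset.mem_image, hD]
    by_cases h1 : v = 1
    · subst h1
      obtain ⟨x, hx, -⟩ := hw.exists_start
      exact iff_of_true ⟨one_mem_targets w, x, hx⟩ (Or.inl rfl)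
    · by_cases h2 : v = 2
      · subst h2
        rw [two_mem_targets hn, ← hD]
        simp only [h2D, h1, false_iff]
        simp
      · simp only [h1, false_or, Finset.mem_insert, Finset.mem_singleton, h2, not_false_eq_true,
          and_true]
        constructor
        · rintro ⟨hv, y, hy⟩
          obtain ⟨u, hu⟩ := h.exists_redAdj_in (s := true) h1 h2 hy
          exact ⟨_, (hW _).2 ⟨mem_of_tgt (s := true) h hw h1 h2 hv hu, rfl⟩, rfl⟩
        · rintro ⟨e, he, rfl⟩
          exact ⟨(mem_targets_of_ne h1 h2).2 ⟨e, ((hW e).1 he).1, rfl⟩,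
            h.exists_redAdj_out (s := true) h1 h2 (hWadj e he)⟩
  have hTcard : (targets w ∩ D).card = (W.image CrabEdge.tgt \ {1, 2}).card + 1 := by
    rw [hT, Finset.card_insert_of_notMem (by simp)]
  have hfinW : ∀ e ∈ W, (e.tgt = 1 ∨ e.tgt = 2) → e.IsFinal := by
    rintro ⟨_ | _, u, v⟩ he hv
    · exact hv
    · simpa using ((hW _).1 he).2
  rw [hTcard, hS, hsrc, ← htgt]
  obtain ⟨e, he, hf, huniq⟩ := hw.exists_isFinal
  -- If 2 is a source, the final edge is light and no dark edge traveled ends at 1 or 2. Otherwise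
  -- the final edge is dark, and its discarded endpoint makes up for the added node 1.
  split_ifs with h2
  · congr 2
    rw [Finset.sdiff_eq_self_iff_disjoint, Finset.disjoint_left]
    intro v hv hv12
    obtain ⟨a, ha, rfl⟩ := Finset.mem_image.1 hv
    have hae := huniq a ((hW a).1 ha).1 (hfinW a ha (by simpa using hv12))
    obtain ⟨⟨_ | _, u, y⟩, hb, rfl⟩ := mem_sources.1 h2
    · exact (before_dark h hw hb (one_ne_two hn).symm).1 rfl
    · have hbe := huniq _ hb (Or.inr rfl)
      have := ((hW a).1 ha).2
      rw [hae, ← hbe] at this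
      simp at this
  · obtain ⟨_ | _, u, y⟩ := e
    · have heW : (⟨Shade.dark, u, y⟩ : CrabEdge n) ∈ W := (hW _).2 ⟨he, rfl⟩
      have himg : W.image CrabEdge.tgt = insert y (W.image CrabEdge.tgt \ {1, 2}) := by
        ext v
        rw [Finset.mem_insert, Finset.mem_sdiff]
        constructor
        · intro hv
          by_cases hv12 : v ∈ ({1, 2} : Finset (Fin (n + 1)))
          · obtain ⟨a, ha, rfl⟩ := Finset.mem_image.1 hv
            rw [huniq a ((hW a).1 ha).1 (hfinW a ha (by simpa using hv12))]
            exact Or.inl rfl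
          · exact Or.inr ⟨hv, hv12⟩
        · rintro (rfl | hv)
          · exact Finset.mem_image.2 ⟨_, heW, rfl⟩
          · exact hv.1
      have hy : y = 1 ∨ y = 2 := hf
      conv_rhs => rw [himg]
      rw [Finset.card_insert_of_notMem (by rcases hy with rfl | rfl <;> simp)]
    · have hin : RedAdj P.2 u y := hw.isIn he
      rcases (hf : u = 1 ∨ u = 2) with rfl | rfl
      · exact absurd rfl (h.ne_one_of_light hin)
      · exact absurd (mem_sources.2 ⟨_, he, rfl⟩) h2

/-- Outside `D` the slot in the first graph is not red, so sources and targets agree there by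
compatibility; only the discrepancy inside `D` matters. -/
theorem neg_one_pow_card (hn : 2 ≤ n) (h : IsBalanced P o) (hw : IsCrabwalk P.1 P.2 w) :
    (-1 : ℤˣ) ^ ((sources w).card + (targets w).card) = if 2 ∈ sources w then -1 else 1 := by
  classical
  let D : Finset (Fin (n + 1)) := Finset.univ.filter fun u => RedSlot P (u, true)
  have hD : ∀ u, u ∈ D ↔ RedSlot P (u, true) := by
    intro u
    simp [D]
  have h1 := card_filter_sources hn h hw D hD
  have h2 : sources w \ D = targets w \ D := by
    ext u
    rw [Finset.mem_sdiff, Finset.mem_sdiff]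
    exact and_congr_left fun hu => (compatible hn h hw).black (u, true) (mt (hD u).2 hu)
  have h3 := Finset.card_inter_add_card_sdiff (sources w) D
  have h4 := Finset.card_inter_add_card_sdiff (targets w) D
  rw [h2] at h3
  have h5 : (sources w).card + (targets w).card = 2 * (sources w).card +
      if 2 ∈ sources w then 1 else 0 := by omega
  rw [h5, pow_add, pow_mul]
  split_ifs <;> simp

end IsCrabwalk

/-! ### The rule φ₁ on balanced pairs -/

theorem IsBalanced.exists_edge_one (hn : 2 ≤ n) {P : GraphPair n} {o : Bool}
    (h : IsBalanced P o) : ∃ x c, (⟨1, x, c⟩ : Edge n) ∈ P.1 := by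
  obtain ⟨⟨_, x, c⟩, he, rfl⟩ := h.exists_edge true 1 ⟨one_ne_zero' hn, landing_one _ _⟩
  exact ⟨x, c, he⟩

theorem IsBalanced.edge_one_unique {P : GraphPair n} {o : Bool} (h : IsBalanced P o)
    {x y : Fin (n + 1)} {c d : EdgeColor} (hx : (⟨1, x, c⟩ : Edge n) ∈ P.1)
    (hy : (⟨1, y, d⟩ : Edge n) ∈ P.1) : x = y ∧ c = d := by
  simpa using h.unique true _ hx _ hy rfl

theorem IsBalanced.moveEdge_eq {P : GraphPair n} {o : Bool} (h : IsBalanced P o)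
    {x : Fin (n + 1)} {c : EdgeColor} (hx : (⟨1, x, c⟩ : Edge n) ∈ P.1) :
    moveEdge P ⟨1, x, c⟩ = RedHotPotato.swapOn {1} P := by
  have h1 : ∀ e ∈ P.1, e.src = 1 ↔ e = ⟨1, x, c⟩ := fun e he =>
    ⟨fun hs => h.unique true e he _ hx hs, fun hs => by rw [hs]⟩
  refine Prod.ext ?_ ?_ <;> ext e
  · simp only [moveEdge, RedHotPotato.swapOn, Set.mem_union, Set.mem_singleton_iff, Finset.mem_singleton,
      Set.mem_ofPred_eq]
    constructor
    · rintro (he | rfl)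
      · exact Or.inr ⟨he, h.ne_one_of_light he⟩
      · exact Or.inl ⟨hx, rfl⟩
    · rintro (⟨he, hs⟩ | ⟨he, -⟩)
      · exact Or.inr ((h1 e he).1 hs)
      · exact Or.inl he
  · simp only [moveEdge, RedHotPotato.swapOn, Set.mem_union, Set.mem_sdiff, Set.mem_singleton_iff,
      Finset.mem_singleton, Set.mem_ofPred_eq]
    constructor
    · rintro ⟨he, hs⟩
      exact Or.inr ⟨he, mt (h1 e he).1 hs⟩
    · rintro (⟨he, hs⟩ | ⟨he, hs⟩)
      · exact absurd hs (h.ne_one_of_light he)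
      · exact ⟨he, mt (h1 e he).2 hs⟩

theorem IsBalanced.compatible_singleton {P : GraphPair n} {o : Bool}
    (h : IsBalanced P o) {x : Fin (n + 1)} (hx : (⟨1, x, EdgeColor.black⟩ : Edge n) ∈ P.1) :
    Compatible P {1} {1} where
  one_mem_left := by simp
  one_mem_right := by simp
  two_mem_iff := Iff.rfl
  black _ _ := Iff.rfl
  red s u v hr h1 _ := by
    have hu : u ≠ 1 := by
      rintro rfl
      cases s
      · exact h.ne_one_of_light hr rfl
      · exact EdgeColor.noConfusion (h.edge_one_unique hx hr).2
    simp [h1, hu]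

theorem IsBalanced.exists_phiOneRule (hn : 2 ≤ n) {P : GraphPair n} {o : Bool}
    (h : IsBalanced P o) : ∃ Q, PhiOneRule P Q := by
  obtain ⟨x, _ | _, hx⟩ := h.exists_edge_one hn
  · exact ⟨_, Or.inl ⟨x, hx, rfl⟩⟩
  · obtain ⟨w, hw⟩ := h.exists_isCrabwalk hx
    exact ⟨_, Or.inr ⟨w, hw, rfl⟩⟩

theorem IsBalanced.phiOneRule_unique {P Q Q' : GraphPair n} {o : Bool} (h : IsBalanced P o)
    (hQ : PhiOneRule P Q) (hQ' : PhiOneRule P Q') : Q = Q' := by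
  rcases hQ with ⟨x, hx, rfl⟩ | ⟨w, hw, rfl⟩ <;> rcases hQ' with ⟨y, hy, rfl⟩ | ⟨w', hw', rfl⟩
  · rw [(h.edge_one_unique hx hy).1]
  · obtain ⟨y, hy, -⟩ := hw'.exists_start
    exact EdgeColor.noConfusion (h.edge_one_unique hx hy).2
  · obtain ⟨x, hx, -⟩ := hw.exists_start
    exact EdgeColor.noConfusion (h.edge_one_unique hx hy).2
  · rw [h.isCrabwalk_unique hw hw']

/-- The sign in `S₁ - S₂` of a pair in `S₁` (`o = true`) or in `S₂` (`o = false`). -/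
noncomputable def signedParity (P : GraphPair n) (o : Bool) : ℤˣ :=
  (if o then 1 else -1) * (-1) ^ (IsBalanced.orbits P o).ncard

/-- If 2 ∈ M, the owner of node 2 is unchanged and the orbit parity changes; otherwise the owner
changes, which reverses the sign, and the orbit parity is kept. -/
theorem IsBalanced.signedParity_swapOn (hn : 2 ≤ n) {P : GraphPair n} {o : Bool}
    (h : IsBalanced P o) {M N : Finset (Fin (n + 1))} (hc : Compatible P M N)
    (hcard : (-1 : ℤˣ) ^ (M.card + N.card) = if 2 ∈ M then -1 else 1) :
    signedParity (RedHotPotato.swapOn M P) (newOwner M o) = -signedParity P o := by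
  rw [signedParity, signedParity, h.neg_one_pow_ncard_orbits_swapOn hn hc, hcard]
  by_cases h2 : 2 ∈ M
  · simp [newOwner, flipSide, h2]
  · cases o <;> simp [newOwner, flipSide, h2]

/-- The rule `φ₁` preserves balanced pairs, is symmetric and reverses signs. -/
theorem IsBalanced.phiOneRule (hn : 2 ≤ n) {P Q : GraphPair n} {o : Bool} (h : IsBalanced P o)
    (hQ : PhiOneRule P Q) :
    ∃ o', IsBalanced Q o' ∧ PhiOneRule Q P ∧ signedParity Q o' = -signedParity P o := by
  rcases hQ with ⟨x, hx, rfl⟩ | ⟨w, hw, rfl⟩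
  · have hc := h.compatible_singleton hx
    have hb := h.swapOn hn hc
    have hx' : (⟨1, x, EdgeColor.black⟩ : Edge n) ∈ (RedHotPotato.swapOn {1} P).1 :=
      Or.inl ⟨hx, by simp⟩
    rw [h.moveEdge_eq hx]
    refine ⟨_, hb, Or.inl ⟨x, hx', ?_⟩, h.signedParity_swapOn hn hc ?_⟩
    · rw [hb.moveEdge_eq hx', swapOn_swapOn]
    · simp [(one_ne_two hn).symm]
  · have hc := hw.compatible hn h
    have hb := h.swapOn hn hc
    have hw' := hw.swapOn h
    rw [hw.moveCrabwalk_eq hn h]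
    refine ⟨_, hb, Or.inr ⟨w, hw', ?_⟩, h.signedParity_swapOn hn hc (hw.neg_one_pow_card hn h)⟩
    rw [hw'.moveCrabwalk_eq hn hb, swapOn_swapOn]

/-- Node 2 has an edge out of it in exactly one graph, which tells S₁ from S₂. -/
theorem IsBalanced.owner_unique (hn : 2 ≤ n) {P : GraphPair n} {o o' : Bool}
    (h : IsBalanced P o) (h' : IsBalanced P o') : o = o' := by
  obtain ⟨e, he, hs⟩ := h.exists_edge o 2 ⟨two_ne_zero' hn, landing_two hn _ _⟩
  have := (h'.isSlot o e he).2
  rw [hs, landing_two hn] at this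
  exact (congrArg Prod.snd this).symm

/-! ### Transfer to the signed set S₁ - S₂ -/

/-- Whether an element of `S₁ - S₂` comes from `S₁`. -/
def owner (x : (SOne n - STwo n).carrier) : Bool :=
  Sum.elim (fun _ : (SOne n).carrier => true) (fun _ : (STwo n).carrier => false) x

theorem isBalanced_toPair (hn : 2 ≤ n) (x : (SOne n - STwo n).carrier) :
    IsBalanced (toPair x) (owner x) := by
  rcases x with x | x
  · exact IsPairOne.isBalanced x.2
  · exact IsPairTwo.isBalanced hn x.2

theorem IsBalanced.signedParity_one {P : GraphPair n} (h : IsBalanced P true) :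
    signedParity P true = (-1) ^ (numRedCycles P.1 + numRedCycles P.2) := by
  rw [signedParity, h.ncard_orbits_one, if_pos rfl, one_mul]

theorem IsBalanced.signedParity_two (hn : 2 ≤ n) {P : GraphPair n} (h : IsBalanced P false) :
    signedParity P false =
      -(-1) ^ (numRedCycles P.1 + numRedCycles P.2 + numRedMetaCycles P.1 P.2) := by
  rw [signedParity, h.ncard_orbits_two hn, if_neg (by simp), neg_one_mul]

theorem sign_eq_signedParity (hn : 2 ≤ n) (x : (SOne n - STwo n).carrier) :
    (SOne n - STwo n).sign x = signedParity (toPair x) (owner x) := by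
  have h := isBalanced_toPair hn x
  rcases x with x | x
  · exact (IsBalanced.signedParity_one h).symm
  · exact (IsBalanced.signedParity_two hn h).symm

theorem exists_toPair_eq (hn : 2 ≤ n) {P : GraphPair n} {o : Bool} (h : IsBalanced P o) :
    ∃ x : (SOne n - STwo n).carrier, toPair x = P := by
  cases o
  · exact ⟨Sum.inr ⟨P, h.isPairTwo hn⟩, rfl⟩
  · exact ⟨Sum.inl ⟨P, h.isPairOne⟩, rfl⟩

theorem toPair_injective (hn : 2 ≤ n) :
    Function.Injective (toPair : (SOne n - STwo n).carrier → GraphPair n) := by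
  intro x y hxy
  have ho : owner x = owner y :=
    (isBalanced_toPair hn x).owner_unique hn (hxy ▸ isBalanced_toPair hn y)
  rcases x with x | x <;> rcases y with y | y
  · exact congrArg Sum.inl (Subtype.ext hxy)
  · exact Bool.noConfusion ho
  · exact Bool.noConfusion ho
  · exact congrArg Sum.inr (Subtype.ext hxy)

end RedHotPotato

/-- On every element of `S₁ - S₂` the rule `φ₁` has exactly one outcome (in particular the
crabwalk ends), the outcome is again an element of `S₁ - S₂`, and the map obtained in this way is
a sign-reversing involution. -/
theorem mainTheorem2 (n : ℕ) (hn : 2 ≤ n) :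
    ∃ φ : (RedHotPotato.SOne n - RedHotPotato.STwo n).carrier →
        (RedHotPotato.SOne n - RedHotPotato.STwo n).carrier,
      (∀ (x : (RedHotPotato.SOne n - RedHotPotato.STwo n).carrier)
          (Q : RedHotPotato.GraphPair n),
        RedHotPotato.PhiOneRule (RedHotPotato.toPair x) Q ↔ Q = RedHotPotato.toPair (φ x)) ∧
      RedHotPotato.IsSignReversingInvolution (RedHotPotato.SOne n - RedHotPotato.STwo n) φ := by
  have hbal := RedHotPotato.isBalanced_toPair hn
  have hex : ∀ x : (RedHotPotato.SOne n - RedHotPotato.STwo n).carrier,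
      ∃ y : (RedHotPotato.SOne n - RedHotPotato.STwo n).carrier,
        RedHotPotato.PhiOneRule (RedHotPotato.toPair x) (RedHotPotato.toPair y) := by
    intro x
    obtain ⟨Q, hQ⟩ := (hbal x).exists_phiOneRule hn
    obtain ⟨o', hb, -⟩ := (hbal x).phiOneRule hn hQ
    obtain ⟨y, rfl⟩ := RedHotPotato.exists_toPair_eq hn hb
    exact ⟨y, hQ⟩
  choose φ hφ using hex
  refine ⟨φ, fun x Q => ⟨fun hQ => (hbal x).phiOneRule_unique hQ (hφ x), ?_⟩, fun x => ?_,
    fun x => ?_⟩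
  · rintro rfl
    exact hφ x
  -- The rule is symmetric, so x and φ (φ x) are both outcomes of it at φ x.
  · obtain ⟨o', hb, hr, -⟩ := (hbal x).phiOneRule hn (hφ x)
    exact RedHotPotato.toPair_injective hn (hb.phiOneRule_unique (hφ (φ x)) hr)
  · obtain ⟨o', hb, -, hs⟩ := (hbal x).phiOneRule hn (hφ x)
    rw [RedHotPotato.sign_eq_signedParity hn, RedHotPotato.sign_eq_signedParity hn, ← hs,
      (hbal (φ x)).owner_unique hn hb]
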